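/- Let $K$ be a quartic number field with ring of integers $\mathcal O_K$, and let $\nu_1,\nu_2,\nu_3,\nu_4\in\mathcal O_K$ form a $\mathbb Q$-basis $\mathbf v$ of $K$ with $\nu_1=1$ and $K=\mathbb Q(\nu_2)$. For a nonzero ideal $\mathfrak d$ of $\mathcal O_K$ with norm $N(\mathfrak d)$ put $$\varrho_{\mathbf v}(\mathfrak d)=\frac{\#\{\mathbf a\in\mathbb Z^3\cap[1,N(\mathfrak d)]^3:\ \mathfrak d\mid (a_1\nu_1+a_2\nu_2+a_3\nu_3)\}}{N(\mathfrak d)^2}.$$ Let $k\in\mathbb N$ and $\varepsilon>0$. There is a constant $C>0$, depending only on $K,\mathbf v,k,\varepsilon$, such that the following holds. Let $X$ and $D>0$ be real, let $q\ge 1$ be an integer with $q\le\sqrt X$, let $\mathbf u_0\in\mathbb Z^3$, and let $\mathcal R\subset[-X,X]^3$ be a Lebesgue measurable set. Put $$\Gamma=\Big\{\sum_{i=1}^3a_i\nu_i:\ \mathbf a\in\mathbb Z^3\cap\mathcal R,\ \mathbf a\equiv\mathbf u_0\ (\mathrm{mod}\ q)\Big\},\qquad \Gamma_{\mathfrak d}=\{\kappa\in\Gamma:\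 \mathfrak d\mid(\kappa)\},$$ $$S=\sum_{\substack{N(\mathfrak d)\in[D,2D]\\ (N(\mathfrak d),q)=1}}\bigg|\,|\Gamma_{\mathfrak d}|-\frac{\varrho_{\mathbf v}(\mathfrak d)\,\mathrm{vol}(\mathcal R)}{q^3N(\mathfrak d)}\bigg|,$$ where the sum runs over ideals $\mathfrak d$ of $\mathcal O_K$. (i) If every line parallel to a coordinate axis meets $\mathcal R$ in a union of at most $k$ intervals, then $$S\le C\big(X^{2+\varepsilon}q^{1+\varepsilon}D^{1/3+\varepsilon}+Dq^{4+\varepsilon}\big).$$ (ii) If every line, in any direction, meets $\mathcal R$ in a union of at most $k$ intervals, then $$S\le C\big(X^{2}q^{1+\varepsilon}D^{1/3+\varepsilon}+Dq^{4+\varepsilon}\big).$$ -/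

import Mathlib

open NumberField

noncomputable section

namespace IncompleteNorm

/-- Every line with direction `v` meets `R` in a union of at most `k` intervals
(intervals may be open, closed, half-open, empty, or reduced to a point). -/
def LinesMeetInIntervals (R : Set (Fin 3 → ℝ)) (v : Fin 3 → ℝ) (k : ℕ) : Prop :=
  ∀ p : Fin 3 → ℝ, ∃ I : Fin k → Set ℝ,
    (∀ j, (I j).OrdConnected) ∧ {t : ℝ | p + t • v ∈ R} = ⋃ j, I j

/-- Every line parallel to a coordinate axis meets `R` in at most `k` intervals. -/
def AxisNice (R : Set (Fin 3 → ℝ)) (k : ℕ) : Prop :=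
  ∀ i : Fin 3, LinesMeetInIntervals R (Pi.single i 1) k

/-- Every line, in whatever direction, meets `R` in at most `k` intervals. -/
def LineNice (R : Set (Fin 3 → ℝ)) (k : ℕ) : Prop :=
  ∀ v : Fin 3 → ℝ, v ≠ 0 → LinesMeetInIntervals R v k

variable {K : Type*} [Field K] [NumberField K]

/-- The element `a₁ν₁ + a₂ν₂ + a₃ν₃`; the vector `(ν₁, ν₂, ν₃, ν₄)` is indexed by `0, 1, 2, 3`. -/
def incompleteSum (ν : Fin 4 → 𝓞 K) (a : Fin 3 → ℤ) : 𝓞 K :=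
  ∑ i : Fin 3, (a i : 𝓞 K) * ν i.castSucc

/-- The function `ϱ_v(𝔡)`: the number of `a ∈ {1, …, N(𝔡)}³` with `𝔡 ∣ (a₁ν₁ + a₂ν₂ + a₃ν₃)`,
divided by `N(𝔡)²`. -/
def rho (ν : Fin 4 → 𝓞 K) (𝔡 : Ideal (𝓞 K)) : ℝ :=
  (Set.ncard {a : Fin 3 → ℤ | (∀ i, 1 ≤ a i ∧ a i ≤ (Ideal.absNorm 𝔡 : ℤ)) ∧
    𝔡 ∣ Ideal.span {incompleteSum ν a}} : ℝ) / (Ideal.absNorm 𝔡 : ℝ) ^ 2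

/-- The set `Γ` of all `a₁ν₁ + a₂ν₂ + a₃ν₃` with `a ∈ ℤ³ ∩ R` and `a ≡ u (mod q)`. -/
def Gam (ν : Fin 4 → 𝓞 K) (R : Set (Fin 3 → ℝ)) (u : Fin 3 → ℤ) (q : ℕ) : Set (𝓞 K) :=
  {κ | ∃ a : Fin 3 → ℤ, (fun i => (a i : ℝ)) ∈ R ∧ (∀ i, a i ≡ u i [ZMOD (q : ℤ)]) ∧
    κ = incompleteSum ν a}

/-- The set `Γ_𝔡` of all `κ ∈ Γ` with `𝔡 ∣ (κ)`. -/
def GamDvd (ν : Fin 4 → 𝓞 K) (R : Set (Fin 3 → ℝ)) (u : Fin 3 → ℤ) (q : ℕ)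
    (𝔡 : Ideal (𝓞 K)) : Set (𝓞 K) :=
  {κ ∈ Gam ν R u q | 𝔡 ∣ Ideal.span {κ}}

variable (K) in
theorem finite_idealRange (D : ℝ) (q : ℕ) :
    {𝔡 : Ideal (𝓞 K) | (Ideal.absNorm 𝔡 : ℝ) ∈ Set.Icc D (2 * D) ∧
      (Ideal.absNorm 𝔡).Coprime q}.Finite := by
  refine (Ideal.finite_setOf_absNorm_le (S := 𝓞 K) ⌊2 * D⌋₊).subset ?_
  rintro 𝔡 ⟨h, -⟩
  exact Nat.le_floor h.2

variable (K) in
/-- The ideals `𝔡` of `𝓞 K` with `N(𝔡) ∈ [D, 2D]` and `(N(𝔡), q) = 1`. -/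
def idealRange (D : ℝ) (q : ℕ) : Finset (Ideal (𝓞 K)) :=
  (finite_idealRange K D q).toFinset

/-- The sum, over the ideals `𝔡` with `N(𝔡) ∈ [D, 2D]` and `(N(𝔡), q) = 1`, of
`| |Γ_𝔡| - ϱ_v(𝔡) vol(R) / (q³ N(𝔡)) |`. -/
def typeISum (ν : Fin 4 → 𝓞 K) (R : Set (Fin 3 → ℝ)) (u : Fin 3 → ℤ) (q : ℕ) (D : ℝ) : ℝ :=
  ∑ 𝔡 ∈ idealRange K D q,
    |((GamDvd ν R u q 𝔡).ncard : ℝ) -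
      rho ν 𝔡 * MeasureTheory.volume.real R / ((q : ℝ) ^ 3 * (Ideal.absNorm 𝔡 : ℝ))|

end IncompleteNorm

end

/-! ### Integer points in regions that lines meet in few intervals. -/

noncomputable section

namespace IncompleteNorm

/-! For an ideal `𝔡` let `Λ` be the lattice of integer vectors `a` whose incomplete sum lies in `𝔡`.
It contains `N(𝔡)ℤ³`, and periodicity gives `ϱ(𝔡)/N(𝔡) = 1/[ℤ³ : Λ]` (`rho_div_absNorm`). Writing `a
= u + qn`, with `q` invertible modulo `N(𝔡)`, turns `|Γ_𝔡|` into the number of points of one coset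
`c + Λ` in the rescaled region (`exists_ncard_GamDvd_eq`). This must be compared with volume over
index, with an error governed by the least sup norm `m` of a nonzero vector of `Λ`.

If all lines meet the region in few intervals, a reduced basis of `Λ` transforms `Λ` into `ℤ³`, and
moving between cosets changes the count by `O((X/m)² + 1)` (`ncard_coset_le`). Averaging over cosets
gives the number of integer points divided by the index, and that number is the volume up to
`O(X²)`.

If only axis-parallel lines are controlled, skew bases are not available. The count is instead
averaged over a cube of translates of side `L`, and the side is then doubled until it exceeds the
region. Each doubling costs `O(X²(1/m² + 1/L²))`, since cubes are equidistributed by the convex case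
and axis translations move few points (`abs_boxAvg_sub_boxAvg_le`); the number of doublings accounts
for an `X^ε`. The initial averaging costs the boundary points in the coset, and is controlled only
after summing over ideals: a nonzero value of the form has few ideal divisors
(`exists_sum_boundary_le`). The choice `L ≈ D^{1/3}` balances the costs.

In both cases it remains to sum `1/m²`. Since `m³ ≤ [ℤ³ : Λ] ≤ 2D`, the shortest vector has size at
most `(2D)^{1/3}`; each nonzero vector serves few ideals, and `∑ |a|⁻²` over `|a| ≤ P` is `O(P)`.
This yields `D^{1/3+ε}` (`exists_sum_inv_minNorm_sq_le`). The remaining bounded errors are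
multiplied by the `O(D)` ideals in the range. -/

/-- An integer vector, viewed as a real vector. -/
def castVec (n : Fin 3 → ℤ) : Fin 3 → ℝ := fun i => (n i : ℝ)

/-- The integer vectors whose translate by `w` lies in `S`. -/
def latticePts (S : Set (Fin 3 → ℝ)) (w : Fin 3 → ℝ) : Set (Fin 3 → ℤ) :=
  {n | castVec n + w ∈ S}

/-- Any two points of `S` differ by at most `W` in each coordinate. -/
def SpreadLE (S : Set (Fin 3 → ℝ)) (W : ℕ) : Prop :=
  ∀ x ∈ S, ∀ y ∈ S, ∀ i, x i - y i ≤ W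

@[simp] theorem castVec_apply (n : Fin 3 → ℤ) (i : Fin 3) : castVec n i = (n i : ℝ) := rfl

@[simp] theorem castVec_zero : castVec 0 = 0 := by ext; simp

theorem castVec_add (a b : Fin 3 → ℤ) : castVec (a + b) = castVec a + castVec b := by
  ext i; simp

theorem castVec_sub (a b : Fin 3 → ℤ) : castVec (a - b) = castVec a - castVec b := by
  ext i; simp

theorem castVec_injective : Function.Injective castVec := by
  intro a b h
  ext i
  have := congrFun h i
  simpa using this

theorem mem_Icc_of_spread {S : Set (Fin 3 → ℝ)} {W : ℕ} (hW : SpreadLE S W) {w : Fin 3 → ℝ}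
    {m n : Fin 3 → ℤ} (hm : m ∈ latticePts S w) (hn : n ∈ latticePts S w) (i : Fin 3) :
    n i ∈ Finset.Icc (m i - W) (m i + W) := by
  have h1 := hW _ hm _ hn i
  have h2 := hW _ hn _ hm i
  simp only [Pi.add_apply, castVec_apply] at h1 h2
  rw [Finset.mem_Icc]
  constructor
  · have : (m i : ℝ) - n i ≤ W := by linarith
    have : m i - n i ≤ (W : ℤ) := by exact_mod_cast this
    omega
  · have : (n i : ℝ) - m i ≤ W := by linarith
    have : n i - m i ≤ (W : ℤ) := by exact_mod_cast this
    omega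

theorem finite_latticePts {S : Set (Fin 3 → ℝ)} {W : ℕ} (hW : SpreadLE S W) (w : Fin 3 → ℝ) :
    (latticePts S w).Finite := by
  rcases (latticePts S w).eq_empty_or_nonempty with h | ⟨m, hm⟩
  · simp [h]
  · refine (Fintype.piFinset fun i => Finset.Icc (m i - (W : ℤ)) (m i + W)).finite_toSet.subset ?_
    intro n hn
    rw [Finset.mem_coe, Fintype.mem_piFinset]
    exact mem_Icc_of_spread hW hm hn

theorem ncard_latticePts_le {S : Set (Fin 3 → ℝ)} {W : ℕ} (hW : SpreadLE S W)
    (w : Fin 3 → ℝ) : (latticePts S w).ncard ≤ (2 * W + 1) ^ 3 := by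
  rcases (latticePts S w).eq_empty_or_nonempty with h | ⟨m, hm⟩
  · simp [h]
  · have hsub : latticePts S w ⊆
        ((Fintype.piFinset fun i => Finset.Icc (m i - (W : ℤ)) (m i + W)) : Set (Fin 3 → ℤ)) := by
      intro n hn
      rw [Finset.mem_coe, Fintype.mem_piFinset]
      exact mem_Icc_of_spread hW hm hn
    refine (Set.ncard_le_ncard hsub (Finset.finite_toSet _)).trans ?_
    rw [Set.ncard_coe_finset, Fintype.card_piFinset]
    have : ∀ i, (Finset.Icc (m i - (W : ℤ)) (m i + W)).card = 2 * W + 1 := by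
      intro i; rw [Int.card_Icc]; omega
    simp [this]

theorem latticePts_add_castVec (S : Set (Fin 3 → ℝ)) (w : Fin 3 → ℝ) (z : Fin 3 → ℤ) :
    (latticePts S (w + castVec z)).ncard = (latticePts S w).ncard := by
  refine Set.ncard_congr (fun n _ => n + z) ?_ ?_ ?_
  · intro n hn
    simp only [latticePts, Set.mem_ofPred_eq, castVec_add] at hn ⊢
    convert hn using 1; abel
  · intro a b _ _ h; exact add_right_cancel h
  · intro n hn
    refine ⟨n - z, ?_, by simp⟩
    simp only [latticePts, Set.mem_ofPred_eq, castVec_sub] at hn ⊢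
    convert hn using 1; abel

/-- The number of lattice points that leave `S` under a short translation along an axis. -/
theorem ncard_leaving_le {S : Set (Fin 3 → ℝ)} {W k : ℕ} (hW : SpreadLE S W) {i : Fin 3}
    (hS : LinesMeetInIntervals S (Pi.single i 1) k) (w : Fin 3 → ℝ) {t : ℝ} (ht0 : 0 ≤ t)
    (ht1 : t ≤ 1) :
    {n | n ∈ latticePts S w ∧ n ∉ latticePts S (w + t • Pi.single i 1)}.ncard
      ≤ k * (2 * W + 1) ^ 2 := by
  classical
  set B := {n | n ∈ latticePts S w ∧ n ∉ latticePts S (w + t • Pi.single i 1)} with hB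
  rcases B.eq_empty_or_nonempty with h | ⟨m, hm⟩
  · simp [h]
  choose I hI hIS using hS
  set base : (Fin 3 → ℤ) → (Fin 3 → ℝ) := fun n => castVec (Function.update n i 0) + w with hbase
  have hdec : ∀ n : Fin 3 → ℤ, castVec n + w = base n + (n i : ℝ) • Pi.single i 1 := by
    intro n
    ext l
    by_cases hl : l = i
    · subst hl; simp [hbase, add_comm]
    · simp [hbase, hl]
  have hex : ∀ n ∈ B, ∃ j, (n i : ℝ) ∈ I (base n) j := by
    intro n hn
    have h1 : (n i : ℝ) ∈ {s : ℝ | base n + s • Pi.single i 1 ∈ S} := by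
      rw [Set.mem_ofPred_eq, ← hdec]; exact hn.1
    rw [hIS] at h1
    simpa using h1
  set T : Finset (Fin 3 → ℤ) := Fintype.piFinset fun l =>
    if l = i then {0} else Finset.Icc (m l - (W : ℤ)) (m l + W) with hT
  have hTcard : T.card = (2 * W + 1) ^ 2 := by
    have : ∀ l, (Finset.Icc (m l - (W : ℤ)) (m l + W)).card = 2 * W + 1 := by
      intro l; rw [Int.card_Icc]; omega
    rw [hT, Fintype.card_piFinset, Fin.prod_univ_three]
    fin_cases i <;> simp [this, sq]
  have key : B.ncard ≤ ((Finset.univ ×ˢ T : Finset (Fin k × (Fin 3 → ℤ))) :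
      Set (Fin k × (Fin 3 → ℤ))).ncard := by
    have hk : Nonempty (Fin k) := ⟨(hex m hm).choose⟩
    refine Set.ncard_le_ncard_of_injOn
      (fun n => (if h : n ∈ B then (hex n h).choose else Classical.arbitrary _,
        Function.update n i 0)) ?_ ?_ (Finset.finite_toSet _)
    · intro n hn
      rw [Finset.mem_coe, Finset.mem_product]
      refine ⟨Finset.mem_univ _, ?_⟩
      rw [hT, Fintype.mem_piFinset]
      intro l
      by_cases hl : l = i
      · subst hl; simp
      · simpa only [hl, if_false, Function.update_of_ne hl, ne_eq, not_false_eq_true] using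
          mem_Icc_of_spread hW hm.1 hn.1 l
    -- If `a`, `b` on one axis line share an interval and `a i < b i`, then `a i + t` with `t ≤ 1`
    -- lies between them, so `a` does not leave `S`. Hence each line and each interval contribute at
    -- most one leaving point.
    · have main : ∀ a ∈ B, ∀ b ∈ B, base a = base b →
          (∃ j, (a i : ℝ) ∈ I (base a) j ∧ (b i : ℝ) ∈ I (base b) j) → ¬ a i < b i := by
        rintro a ha b hb hab ⟨j, hja, hjb⟩ hlt
        apply ha.2
        rw [← hab] at hjb
        have h1 : (a i : ℝ) + t ∈ I (base a) j := by
          refine (hI _ j).out hja hjb ⟨by linarith, ?_⟩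
          have : (a i : ℝ) + 1 ≤ b i := by exact_mod_cast hlt
          linarith
        have h2 : (a i : ℝ) + t ∈ {s : ℝ | base a + s • Pi.single i 1 ∈ S} := by
          rw [hIS]; exact Set.mem_iUnion.2 ⟨j, h1⟩
        have h3 : castVec a + (w + t • Pi.single i 1) =
            base a + ((a i : ℝ) + t) • Pi.single i 1 := by
          rw [← add_assoc, hdec, add_smul, add_assoc]
        show castVec a + (w + t • Pi.single i 1) ∈ S
        rw [h3]; exact h2
      intro a ha b hb hab
      simp only [ha, hb, dif_pos, Prod.mk.injEq] at hab
      obtain ⟨h1, h2⟩ := hab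
      have hbb : base a = base b := by simp only [hbase, h2]
      have hja := (hex a ha).choose_spec
      have hjb := (hex b hb).choose_spec
      rw [← h1] at hjb
      have e : a i = b i := by
        apply le_antisymm
        · exact not_lt.1 (main b hb a ha hbb.symm ⟨_, hjb, hja⟩)
        · exact not_lt.1 (main a ha b hb hbb ⟨_, hja, hjb⟩)
      ext l
      by_cases hl : l = i
      · rw [hl, e]
      · have := congrFun h2 l
        simpa [hl] using this
  rw [Set.ncard_coe_finset, Finset.card_product, hTcard] at key
  simpa using key

/-- Integer translations preserve the count, so only the fractional part of `t` matters, and for it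
just the leaving points can be lost. -/
theorem ncard_latticePts_axis {S : Set (Fin 3 → ℝ)} {W k : ℕ} (hW : SpreadLE S W) {i : Fin 3}
    (hS : LinesMeetInIntervals S (Pi.single i 1) k) (w : Fin 3 → ℝ) (t : ℝ) :
    (latticePts S w).ncard ≤
      (latticePts S (w + t • Pi.single i 1)).ncard + k * (2 * W + 1) ^ 2 := by
  have h0 : (latticePts S (w + t • Pi.single i 1)).ncard =
      (latticePts S (w + Int.fract t • Pi.single i 1)).ncard := by
    rw [← latticePts_add_castVec S (w + Int.fract t • Pi.single i 1) (Pi.single i ⌊t⌋)]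
    congr 2
    rw [add_assoc]
    congr 1
    ext l
    by_cases hl : l = i
    · subst hl; simp
    · simp [hl]
  rw [h0]
  have hsub : latticePts S w ⊆ latticePts S (w + Int.fract t • Pi.single i 1) ∪
      {n | n ∈ latticePts S w ∧ n ∉ latticePts S (w + Int.fract t • Pi.single i 1)} := by
    intro n hn
    by_cases h : n ∈ latticePts S (w + Int.fract t • Pi.single i 1)
    · exact Or.inl h
    · exact Or.inr ⟨hn, h⟩
  have hfin' : {n | n ∈ latticePts S w ∧
      n ∉ latticePts S (w + Int.fract t • Pi.single i 1)}.Finite :=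
    (finite_latticePts hW w).subset fun n hn => hn.1
  have hfin := (finite_latticePts hW (w + Int.fract t • Pi.single i 1)).union hfin'
  refine (Set.ncard_le_ncard hsub hfin).trans ((Set.ncard_union_le _ _).trans ?_)
  gcongr
  exact ncard_leaving_le hW hS w (Int.fract_nonneg t) (Int.fract_lt_one t).le

/-- Translating the integer lattice changes the number of its points in `S` by little. -/
theorem ncard_latticePts_le_translate {S : Set (Fin 3 → ℝ)} {W k : ℕ} (hW : SpreadLE S W)
    (hS : AxisNice S k) (w w' : Fin 3 → ℝ) :
    (latticePts S w).ncard ≤ (latticePts S w').ncard + 3 * (k * (2 * W + 1) ^ 2) := by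
  have h0 := ncard_latticePts_axis hW (hS 0) w (w' 0 - w 0)
  set w1 := w + (w' 0 - w 0) • (Pi.single 0 1 : Fin 3 → ℝ) with hw1
  have h1 := ncard_latticePts_axis hW (hS 1) w1 (w' 1 - w 1)
  set w2 := w1 + (w' 1 - w 1) • (Pi.single 1 1 : Fin 3 → ℝ) with hw2
  have h2 := ncard_latticePts_axis hW (hS 2) w2 (w' 2 - w 2)
  have : w2 + (w' 2 - w 2) • (Pi.single 2 1 : Fin 3 → ℝ) = w' := by
    ext l
    fin_cases l <;> simp [hw2, hw1]
  rw [this] at h2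
  omega

open MeasureTheory in
/-- The volume of `S` is the average of the number of lattice points over all translates. -/
theorem volume_eq_lintegral_ncard {S : Set (Fin 3 → ℝ)} {W : ℕ} (hW : SpreadLE S W)
    (hS : NullMeasurableSet S volume) :
    volume S = ∫⁻ t in Set.pi Set.univ (fun _ : Fin 3 => Set.Ico (0 : ℝ) 1),
      ((latticePts S t).ncard : ENNReal) := by
  set F : Set (Fin 3 → ℝ) := Set.pi Set.univ (fun _ : Fin 3 => Set.Ico (0 : ℝ) 1) with hF
  have hFm : MeasurableSet F := MeasurableSet.univ_pi fun _ => measurableSet_Ico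
  have hpre : ∀ n : Fin 3 → ℤ, NullMeasurableSet ((fun t => t + castVec n) ⁻¹' S) volume := fun n =>
    hS.preimage (measurePreserving_add_right volume (castVec n)).quasiMeasurePreserving
  have hcount : ∀ t, ((latticePts S t).ncard : ENNReal) =
      ∑' n : Fin 3 → ℤ, ((fun t => t + castVec n) ⁻¹' S).indicator (fun _ => (1 : ENNReal)) t := by
    intro t
    classical
    have hfin := finite_latticePts hW t
    rw [tsum_eq_sum (s := hfin.toFinset), Set.ncard_eq_toFinset_card _ hfin]
    · rw [Finset.sum_congr rfl (g := fun _ => (1 : ENNReal))]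
      · simp
      · intro n hn
        rw [Set.indicator_of_mem]
        rw [Set.Finite.mem_toFinset] at hn
        show t + castVec n ∈ S
        rw [add_comm]; exact hn
    · intro n hn
      rw [Set.indicator_of_notMem]
      intro h
      apply hn
      rw [Set.Finite.mem_toFinset]
      show castVec n + t ∈ S
      rw [add_comm]; exact h
  simp_rw [hcount]
  rw [lintegral_tsum]
  -- Unfolding: `S` is cut according to the integer parts of the coordinates, and each piece is
  -- moved into the unit cube.
  · have hpart : S = ⋃ n : Fin 3 → ℤ, S ∩ (fun t => t + castVec (-n)) ⁻¹' F := by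
      ext x
      simp only [Set.mem_iUnion, Set.mem_inter_iff]
      constructor
      · intro hx
        refine ⟨fun i => ⌊x i⌋, hx, ?_⟩
        rw [Set.mem_preimage, hF, Set.mem_univ_pi]
        intro i
        have h1 := Int.floor_le (x i)
        have h2 := Int.lt_floor_add_one (x i)
        simp only [Pi.add_apply, castVec_apply, Pi.neg_apply, Int.cast_neg, Set.mem_Ico]
        constructor <;> linarith
      · rintro ⟨_, h, _⟩; exact h
    conv_lhs => rw [hpart]
    rw [measure_iUnion₀]
    · refine tsum_congr fun n => ?_
      rw [← measure_preimage_add_right volume (castVec n), lintegral_indicator₀]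
      · rw [lintegral_const, one_mul, Measure.restrict_restrict₀, Measure.restrict_apply_univ]
        · congr 1
          ext t
          have : t + castVec n + castVec (-n) = t := by ext; simp
          simp [this]
        · exact (hpre n).mono_ac Measure.restrict_le_self.absolutelyContinuous
      · exact (hpre n).mono_ac Measure.restrict_le_self.absolutelyContinuous
    · intro a b hab
      apply Disjoint.aedisjoint
      rw [Set.disjoint_left]
      rintro x ⟨-, hxa⟩ ⟨-, hxb⟩
      apply hab
      rw [Set.mem_preimage, hF, Set.mem_univ_pi] at hxa hxb
      ext i
      have ha := hxa i
      have hb := hxb i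
      simp only [Pi.add_apply, castVec_apply, Pi.neg_apply, Int.cast_neg, Set.mem_Ico] at ha hb
      have e1 : ⌊x i⌋ = a i := by rw [Int.floor_eq_iff]; constructor <;> linarith
      have e2 : ⌊x i⌋ = b i := by rw [Int.floor_eq_iff]; constructor <;> linarith
      rw [← e1, e2]
    · intro n
      refine hS.inter ?_
      exact (hFm.preimage (measurable_add_const _)).nullMeasurableSet
  · intro n
    refine (aemeasurable_const.indicator₀ ?_)
    exact (hpre n).mono_ac Measure.restrict_le_self.absolutelyContinuous

-- The volume is the mean of the counts over translates, and all these counts agree up to the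
-- translation error. The upper bound also shows that the volume is finite.
open MeasureTheory in
theorem abs_ncard_sub_volume_le {S : Set (Fin 3 → ℝ)} {W k : ℕ} (hW : SpreadLE S W)
    (hN : AxisNice S k) (hS : NullMeasurableSet S volume) :
    |((latticePts S 0).ncard : ℝ) - volume.real S| ≤ 3 * (k * (2 * W + 1) ^ 2) := by
  have hv := volume_eq_lintegral_ncard hW hS
  have hF : volume (Set.pi Set.univ (fun _ : Fin 3 => Set.Ico (0 : ℝ) 1)) = 1 := by
    rw [Real.volume_pi_Ico]; simp
  have hup : volume S ≤ (((latticePts S 0).ncard + 3 * (k * (2 * W + 1) ^ 2) : ℕ) : ENNReal) := by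
    rw [hv]
    calc _ ≤ ∫⁻ t in Set.pi Set.univ (fun _ : Fin 3 => Set.Ico (0 : ℝ) 1),
        (((latticePts S 0).ncard + 3 * (k * (2 * W + 1) ^ 2) : ℕ) : ENNReal) := by
          refine lintegral_mono fun t => ?_
          exact Nat.cast_le.2 (ncard_latticePts_le_translate hW hN t 0)
      _ = _ := by rw [setLIntegral_const, hF, mul_one]
  have hlo : (((latticePts S 0).ncard : ℕ) : ENNReal) ≤
      volume S + ((3 * (k * (2 * W + 1) ^ 2) : ℕ) : ENNReal) := by
    rw [hv]
    calc (((latticePts S 0).ncard : ℕ) : ENNReal) =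
        ∫⁻ t in Set.pi Set.univ (fun _ : Fin 3 => Set.Ico (0 : ℝ) 1),
          (((latticePts S 0).ncard : ℕ) : ENNReal) := by rw [setLIntegral_const, hF, mul_one]
      _ ≤ ∫⁻ t in Set.pi Set.univ (fun _ : Fin 3 => Set.Ico (0 : ℝ) 1),
          (((latticePts S t).ncard : ENNReal) + ((3 * (k * (2 * W + 1) ^ 2) : ℕ) : ENNReal)) := by
          refine lintegral_mono fun t => ?_
          rw [← Nat.cast_add]
          exact Nat.cast_le.2 (ncard_latticePts_le_translate hW hN 0 t)
      _ = _ := by rw [lintegral_add_right _ measurable_const, setLIntegral_const, hF, mul_one]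
  have hne : volume S ≠ ⊤ := ne_top_of_le_ne_top (ENNReal.natCast_ne_top _) hup
  have h1 := ENNReal.toReal_mono (ENNReal.natCast_ne_top _) hup
  have h2 := ENNReal.toReal_mono (ENNReal.add_ne_top.2 ⟨hne, ENNReal.natCast_ne_top _⟩) hlo
  rw [ENNReal.toReal_add hne (ENNReal.natCast_ne_top _)] at h2
  simp only [ENNReal.toReal_natCast] at h1 h2
  push_cast at h1 h2
  rw [abs_le, Measure.real]
  constructor <;> linarith

/-! ### Reduced bases of sublattices of `ℤ³`. -/

section Reduced

variable {V : Type*} [NormedAddCommGroup V] [InnerProductSpace ℝ V]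

/-- The condition for `n = ±1` bounds the inner product by `‖b₀‖²/2`, so the squared norm is at most
`(1/4 + 1/4 + 1/4)‖b₁‖²`, and `3/4 < (7/8)²`. A factor below `1` is what makes rounding of real
coefficients effective. -/
theorem norm_small_combination_le {b₀ b₁ : V} (h01 : ‖b₀‖ ≤ ‖b₁‖)
    (h1 : ∀ n : ℤ, ‖b₁‖ ≤ ‖b₁ + (n : ℝ) • b₀‖) {s t : ℝ} (hs : |s| ≤ 1 / 2) (ht : |t| ≤ 1 / 2) :
    ‖s • b₀ + t • b₁‖ ≤ 7 / 8 * ‖b₁‖ := by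
  have hp := h1 1
  have hm := h1 (-1)
  have hp2 : ‖b₁‖ ^ 2 ≤ ‖b₁ + ((1 : ℤ) : ℝ) • b₀‖ ^ 2 := by gcongr
  have hm2 : ‖b₁‖ ^ 2 ≤ ‖b₁ + ((-1 : ℤ) : ℝ) • b₀‖ ^ 2 := by gcongr
  rw [norm_add_sq_real] at hp2 hm2
  simp only [Int.cast_one, one_smul, Int.cast_neg, neg_smul, inner_neg_right, norm_neg] at hp2 hm2
  have hi : |inner ℝ b₀ b₁| ≤ ‖b₀‖ ^ 2 / 2 := by
    rw [real_inner_comm, abs_le]; constructor <;> linarith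
  have h01' : ‖b₀‖ ^ 2 ≤ ‖b₁‖ ^ 2 := by gcongr
  have hs2 : s ^ 2 ≤ 1 / 4 := by
    have := sq_le_sq' (abs_le.1 hs).1 (abs_le.1 hs).2; linarith
  have ht2 : t ^ 2 ≤ 1 / 4 := by
    have := sq_le_sq' (abs_le.1 ht).1 (abs_le.1 ht).2; linarith
  have hst : |s| * |t| ≤ 1 / 4 := by
    have := mul_le_mul hs ht (abs_nonneg t) (by norm_num); linarith
  have hcross : s * (t * inner ℝ b₀ b₁) ≤ 1 / 4 * (‖b₀‖ ^ 2 / 2) := by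
    calc s * (t * inner ℝ b₀ b₁) ≤ |s * (t * inner ℝ b₀ b₁)| := le_abs_self _
      _ = |s| * |t| * |inner ℝ b₀ b₁| := by rw [abs_mul, abs_mul, mul_assoc]
      _ ≤ _ := mul_le_mul hst hi (abs_nonneg _) (by norm_num)
  apply le_of_sq_le_sq _ (by positivity)
  rw [norm_add_sq_real, real_inner_smul_left, real_inner_smul_right, norm_smul, norm_smul,
    mul_pow, mul_pow, mul_pow, Real.norm_eq_abs, Real.norm_eq_abs, sq_abs, sq_abs]
  have e1 := mul_le_mul_of_nonneg_right hs2 (sq_nonneg ‖b₀‖)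
  have e2 := mul_le_mul_of_nonneg_right ht2 (sq_nonneg ‖b₁‖)
  nlinarith [sq_nonneg ‖b₁‖]

/-- In a reduced basis, the terms of a linear combination do not cancel much. -/
theorem abs_coord_mul_norm_le {b : Fin 3 → V} (h01 : ‖b 0‖ ≤ ‖b 1‖) (h12 : ‖b 1‖ ≤ ‖b 2‖)
    (h1 : ∀ n : ℤ, ‖b 1‖ ≤ ‖b 1 + (n : ℝ) • b 0‖)
    (h2 : ∀ n m : ℤ, ‖b 2‖ ≤ ‖b 2 + ((n : ℝ) • b 0 + (m : ℝ) • b 1)‖)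
    (x : Fin 3 → ℝ) (i : Fin 3) : |x i| * ‖b i‖ ≤ 27 * ‖∑ j, x j • b j‖ := by
  have hround : ∀ s : ℝ, |s - round s| ≤ 1 / 2 := abs_sub_round
  -- Rounding `s` and `t` to integers changes the vector by at most `7/8 ‖b 2‖`, leaving at least
  -- `1/8` of the minimal length.
  have A : ∀ s t : ℝ, ‖b 2‖ / 8 ≤ ‖b 2 + (s • b 0 + t • b 1)‖ := by
    intro s t
    have e1 := h2 (round s) (round t)
    have e2 := norm_small_combination_le h01 h1 (hround s) (hround t)
    have e3 : b 2 + ((round s : ℝ) • b 0 + (round t : ℝ) • b 1) =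
        (b 2 + (s • b 0 + t • b 1)) - ((s - round s) • b 0 + (t - round t) • b 1) := by
      module
    rw [e3] at e1
    have e4 := e1.trans (norm_sub_le _ _)
    linarith
  have B : ∀ s : ℝ, ‖b 1‖ / 2 ≤ ‖b 1 + s • b 0‖ := by
    intro s
    have e1 := h1 (round s)
    have e3 : b 1 + (round s : ℝ) • b 0 = (b 1 + s • b 0) - (s - round s) • b 0 := by module
    rw [e3] at e1
    have e4 := e1.trans (norm_sub_le _ _)
    rw [norm_smul, Real.norm_eq_abs] at e4
    have := mul_le_mul_of_nonneg_right (hround s) (norm_nonneg (b 0))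
    linarith
  set v := ∑ j, x j • b j with hv
  rw [Fin.sum_univ_three] at hv
  have k2 : |x 2| * ‖b 2‖ ≤ 8 * ‖v‖ := by
    by_cases hx : x 2 = 0
    · rw [hx]; simp
    · have e := A (x 0 / x 2) (x 1 / x 2)
      have e' : v = x 2 • (b 2 + ((x 0 / x 2) • b 0 + (x 1 / x 2) • b 1)) := by
        rw [hv, smul_add, smul_add, smul_smul, smul_smul, mul_div_cancel₀ _ hx,
          mul_div_cancel₀ _ hx]
        abel
      rw [e', norm_smul, Real.norm_eq_abs]
      have := mul_le_mul_of_nonneg_left e (abs_nonneg (x 2))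
      linarith
  have k12 : ‖x 0 • b 0 + x 1 • b 1‖ ≤ 9 * ‖v‖ := by
    have : x 0 • b 0 + x 1 • b 1 = v - x 2 • b 2 := by rw [hv]; abel
    rw [this]
    have e := norm_sub_le v (x 2 • b 2)
    rw [norm_smul, Real.norm_eq_abs] at e
    linarith
  have k1 : |x 1| * ‖b 1‖ ≤ 18 * ‖v‖ := by
    by_cases hx : x 1 = 0
    · rw [hx]; simp
    · have e := B (x 0 / x 1)
      have e' : x 0 • b 0 + x 1 • b 1 = x 1 • (b 1 + (x 0 / x 1) • b 0) := by
        rw [smul_add, smul_smul, mul_div_cancel₀ _ hx]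
        abel
      rw [e', norm_smul, Real.norm_eq_abs] at k12
      have := mul_le_mul_of_nonneg_left e (abs_nonneg (x 1))
      linarith
  have k0 : |x 0| * ‖b 0‖ ≤ 27 * ‖v‖ := by
    have : x 0 • b 0 = (x 0 • b 0 + x 1 • b 1) - x 1 • b 1 := by abel
    have e : ‖x 0 • b 0‖ ≤ _ := this ▸ norm_sub_le _ _
    rw [norm_smul, norm_smul, Real.norm_eq_abs, Real.norm_eq_abs] at e
    linarith
  have hn := norm_nonneg v
  fin_cases i
  · exact k0
  · exact k1.trans (by linarith)
  · exact k2.trans (by linarith)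

end Reduced

/-- An integer vector, viewed in Euclidean space. -/
def eucl (a : Fin 3 → ℤ) : EuclideanSpace ℝ (Fin 3) := WithLp.toLp 2 (castVec a)

/-- The integer combinations of the three vectors `b j` are exactly the elements of `Λ`. -/
def Spans (b : Fin 3 → Fin 3 → ℤ) (Λ : AddSubgroup (Fin 3 → ℤ)) : Prop :=
  ∀ n, n ∈ Λ ↔ ∃ x : Fin 3 → ℤ, n = ∑ j, x j • b j

theorem eucl_add_zsmul (a b : Fin 3 → ℤ) (n : ℤ) : eucl (a + n • b) = eucl a + (n : ℝ) • eucl b := by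
  ext i; simp [eucl]

/-- The square of the Euclidean norm, as a natural number. -/
def normSq (a : Fin 3 → ℤ) : ℕ := ∑ i, (a i).natAbs ^ 2

theorem norm_eucl_sq (a : Fin 3 → ℤ) : ‖eucl a‖ ^ 2 = normSq a := by
  rw [EuclideanSpace.norm_sq_eq, normSq]
  push_cast
  refine Finset.sum_congr rfl fun i _ => ?_
  simp [eucl]

theorem norm_eucl_le_iff {a b : Fin 3 → ℤ} : ‖eucl a‖ ≤ ‖eucl b‖ ↔ normSq a ≤ normSq b := by
  rw [← sq_le_sq₀ (norm_nonneg _) (norm_nonneg _), norm_eucl_sq, norm_eucl_sq]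
  exact Nat.cast_le

/-- A basis may have fewer than three elements here; it is padded with zeros, which is why `Spans`
does not ask for independence. -/
theorem exists_spans (Λ : AddSubgroup (Fin 3 → ℤ)) : ∃ b, Spans b Λ := by
  obtain ⟨n, ⟨B⟩⟩ := Submodule.nonempty_basis_of_pid (Pi.basisFun ℤ (Fin 3))
    (AddSubgroup.toIntSubmodule Λ)
  have hn : n ≤ 3 := by
    have h1 : LinearIndependent ℤ (fun i => (B i : Fin 3 → ℤ)) :=
      B.linearIndependent.map' (Submodule.subtype _) (Submodule.ker_subtype _)
    have := h1.fintype_card_le_finrank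
    simpa using this
  refine ⟨fun j => if h : j.1 < n then (B ⟨j.1, h⟩ : Fin 3 → ℤ) else 0, fun m => ?_⟩
  constructor
  · intro hm
    have hr := B.sum_repr ⟨m, hm⟩
    have hr' := congrArg Subtype.val hr
    simp only [AddSubmonoidClass.coe_finsetSum, Submodule.coe_smul] at hr'
    refine ⟨fun j => if h : j.1 < n then B.repr ⟨m, hm⟩ ⟨j.1, h⟩ else 0, ?_⟩
    refine hr'.symm.trans ?_
    refine Finset.sum_of_injOn (Fin.castLE hn) (Fin.castLE_injective hn).injOn
      (fun _ _ => Finset.mem_coe.2 (Finset.mem_univ _)) ?_ ?_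
    · intro j _ hj
      have : ¬ j.1 < n := fun h => hj ⟨⟨j.1, h⟩, Finset.mem_coe.2 (Finset.mem_univ _), rfl⟩
      simp [this]
    · intro i _
      simp
  · rintro ⟨x, rfl⟩
    refine sum_mem fun j _ => Λ.zsmul_mem ?_ _
    by_cases h : j.1 < n
    · simp only [h, dif_pos]; exact (B ⟨j.1, h⟩).2
    · simp only [h, dif_neg, not_false_eq_true]; exact Λ.zero_mem

theorem Spans.perm {b : Fin 3 → Fin 3 → ℤ} {Λ : AddSubgroup (Fin 3 → ℤ)} (h : Spans b Λ)
    (σ : Equiv.Perm (Fin 3)) : Spans (b ∘ σ) Λ := by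
  intro n
  rw [h n]
  constructor
  · rintro ⟨x, rfl⟩
    exact ⟨x ∘ σ, (Equiv.sum_comp σ fun j => x j • b j).symm⟩
  · rintro ⟨x, rfl⟩
    refine ⟨x ∘ σ.symm, ?_⟩
    rw [← Equiv.sum_comp σ fun j => (x ∘ σ.symm) j • b j]
    simp

theorem Spans.reduce_one {b : Fin 3 → Fin 3 → ℤ} {Λ : AddSubgroup (Fin 3 → ℤ)} (h : Spans b Λ)
    (n : ℤ) : Spans ![b 0, b 1 + n • b 0, b 2] Λ := by
  intro a
  rw [h a]
  constructor
  · rintro ⟨x, rfl⟩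
    refine ⟨![x 0 - x 1 * n, x 1, x 2], ?_⟩
    simp only [Fin.sum_univ_three, Matrix.cons_val]
    module
  · rintro ⟨x, rfl⟩
    refine ⟨![x 0 + x 1 * n, x 1, x 2], ?_⟩
    simp only [Fin.sum_univ_three, Matrix.cons_val]
    module

theorem Spans.reduce_two {b : Fin 3 → Fin 3 → ℤ} {Λ : AddSubgroup (Fin 3 → ℤ)} (h : Spans b Λ)
    (n m : ℤ) : Spans ![b 0, b 1, b 2 + n • b 0 + m • b 1] Λ := by
  intro a
  rw [h a]
  constructor
  · rintro ⟨x, rfl⟩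
    refine ⟨![x 0 - x 2 * n, x 1 - x 2 * m, x 2], ?_⟩
    simp only [Fin.sum_univ_three, Matrix.cons_val]
    module
  · rintro ⟨x, rfl⟩
    refine ⟨![x 0 + x 2 * n, x 1 + x 2 * m, x 2], ?_⟩
    simp only [Fin.sum_univ_three, Matrix.cons_val]
    module

/-- Among generating triples one minimizes the sum of squared lengths and sorts by length. Adding
integer multiples of shorter vectors to a longer one keeps the span, so it cannot shorten the
vector. -/
theorem exists_reduced_spans (Λ : AddSubgroup (Fin 3 → ℤ)) : ∃ b, Spans b Λ ∧
    ∀ (x : Fin 3 → ℝ) (i : Fin 3), |x i| * ‖eucl (b i)‖ ≤ 27 * ‖∑ j, x j • eucl (b j)‖ := by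
  obtain ⟨b', hb', hmin'⟩ : ∃ b, Spans b Λ ∧ ∀ c, Spans c Λ →
      ∑ j, normSq (b j) ≤ ∑ j, normSq (c j) := by
    obtain ⟨b, hb, hm⟩ := (measure fun b : Fin 3 → Fin 3 → ℤ => ∑ j, normSq (b j)).wf.has_min
      {b | Spans b Λ} (exists_spans Λ)
    exact ⟨b, hb, fun c hc => not_lt.1 (hm c hc)⟩
  set σ := Tuple.sort fun j => normSq (b' j)
  have hsort := Tuple.monotone_sort fun j => normSq (b' j)
  set b := b' ∘ σ with hbdef
  have hb : Spans b Λ := hb'.perm σ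
  have hmin : ∀ c, Spans c Λ → ∑ j, normSq (b j) ≤ ∑ j, normSq (c j) := by
    intro c hc
    have : ∑ j, normSq (b j) = ∑ j, normSq (b' j) :=
      Equiv.sum_comp σ fun j => normSq (b' j)
    rw [this]; exact hmin' c hc
  refine ⟨b, hb, ?_⟩
  refine abs_coord_mul_norm_le ?_ ?_ ?_ ?_
  · exact norm_eucl_le_iff.2 (hsort (by decide : (0 : Fin 3) ≤ 1))
  · exact norm_eucl_le_iff.2 (hsort (by decide : (1 : Fin 3) ≤ 2))
  · intro n
    rw [← eucl_add_zsmul, norm_eucl_le_iff]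
    have := hmin _ (hb.reduce_one n)
    simp only [Fin.sum_univ_three, Matrix.cons_val] at this
    omega
  · intro n m
    rw [← add_assoc, ← eucl_add_zsmul, ← eucl_add_zsmul, norm_eucl_le_iff]
    have := hmin _ (hb.reduce_two n m)
    simp only [Fin.sum_univ_three, Matrix.cons_val] at this
    omega

theorem eucl_zsmul (n : ℤ) (a : Fin 3 → ℤ) : eucl (n • a) = (n : ℝ) • eucl a := by
  ext i; simp [eucl]

theorem eucl_sum (f : Fin 3 → Fin 3 → ℤ) : eucl (∑ j, f j) = ∑ j, eucl (f j) := by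
  ext i; simp [eucl, Fin.sum_univ_three]

/-- A lattice containing `Nℤ³` spans real space, and three spanning vectors in dimension three are
independent. -/
theorem Spans.linearIndependent {b : Fin 3 → Fin 3 → ℤ} {Λ : AddSubgroup (Fin 3 → ℤ)}
    (h : Spans b Λ) {N : ℕ} (hN : N ≠ 0) (hΛ : ∀ a : Fin 3 → ℤ, N • a ∈ Λ) :
    LinearIndependent ℝ (fun j => eucl (b j)) ∧
      Submodule.span ℝ (Set.range fun j => eucl (b j)) = ⊤ := by
  have htop : ⊤ ≤ Submodule.span ℝ (Set.range fun j => eucl (b j)) := by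
    have hN' : (N : ℝ) ≠ 0 := by exact_mod_cast hN
    have he : ∀ i, eucl (Pi.single i 1) ∈ Submodule.span ℝ (Set.range fun j => eucl (b j)) := by
      intro i
      obtain ⟨x, hx⟩ := (h _).1 (hΛ (Pi.single i 1))
      have e1 : eucl (N • (Pi.single i 1 : Fin 3 → ℤ)) = (N : ℝ) • eucl (Pi.single i 1) := by
        ext l; simp [eucl]
      have e2 : eucl (Pi.single i 1) = (N : ℝ)⁻¹ • ∑ j, (x j : ℝ) • eucl (b j) := by
        rw [eq_inv_smul_iff₀ hN', ← e1, hx, eucl_sum]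
        simp only [eucl_zsmul]
      rw [e2]
      exact Submodule.smul_mem _ _ (Submodule.sum_mem _ fun j _ =>
        Submodule.smul_mem _ _ (Submodule.subset_span ⟨j, rfl⟩))
    intro v _
    have : v = ∑ i, v i • eucl (Pi.single i 1) := by
      ext l
      fin_cases l <;> simp [eucl, Fin.sum_univ_three]
    rw [this]
    exact Submodule.sum_mem _ fun j _ => Submodule.smul_mem _ _ (he j)
  exact ⟨linearIndependent_of_top_le_span_of_card_eq_finrank htop (by simp), top_le_iff.1 htop⟩

/-- The maximum norm of an integer vector. -/
def supNorm (a : Fin 3 → ℤ) : ℕ := Finset.univ.sup fun i => (a i).natAbs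

theorem natAbs_le_supNorm (a : Fin 3 → ℤ) (i : Fin 3) : (a i).natAbs ≤ supNorm a :=
  Finset.le_sup (f := fun i => (a i).natAbs) (Finset.mem_univ i)

theorem supNorm_le_iff {a : Fin 3 → ℤ} {m : ℕ} : supNorm a ≤ m ↔ ∀ i, (a i).natAbs ≤ m := by
  simp [supNorm]

theorem supNorm_le_norm_eucl (a : Fin 3 → ℤ) : (supNorm a : ℝ) ≤ ‖eucl a‖ := by
  obtain ⟨i, -, hi⟩ := Finset.exists_mem_eq_sup Finset.univ Finset.univ_nonempty
    fun i => (a i).natAbs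
  have h := PiLp.norm_apply_le (eucl a) i
  have : ((supNorm a : ℕ) : ℝ) = ‖eucl a i‖ := by
    rw [supNorm, hi]; simp [eucl]
  rw [this]; exact h

theorem norm_toLp_le {y : Fin 3 → ℝ} {W : ℝ} (hW0 : 0 ≤ W) (hy : ∀ i, |y i| ≤ W) :
    ‖(WithLp.toLp 2 y : EuclideanSpace ℝ (Fin 3))‖ ≤ 2 * W := by
  apply le_of_sq_le_sq _ (by positivity)
  rw [EuclideanSpace.norm_sq_eq, Fin.sum_univ_three]
  have h : ∀ i, ‖(WithLp.toLp 2 y : EuclideanSpace ℝ (Fin 3)) i‖ ^ 2 ≤ W ^ 2 := fun i => by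
    have := hy i
    rw [Real.norm_eq_abs]; gcongr
  have := h 0; have := h 1; have := h 2
  nlinarith [sq_nonneg W]

/-! ### Equidistribution among cosets for regions with few intervals on every line. -/

/-- The error in counting points of a lattice with shortest vector of length `m`, in a set of
diameter `W` that meets lines in at most `k` intervals. -/
def cosetError (k W m : ℕ) : ℕ := 3 * (k * (2 * (54 * W / m + 1) + 1) ^ 2)

/-- Two cosets of a lattice have almost as many points in a set that meets lines in few
intervals. -/
theorem ncard_coset_le {S : Set (Fin 3 → ℝ)} {W k : ℕ} (hW : SpreadLE S W) (hS : LineNice S k)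
    {Λ : AddSubgroup (Fin 3 → ℤ)} {N : ℕ} (hN : N ≠ 0) (hΛ : ∀ a : Fin 3 → ℤ, N • a ∈ Λ)
    {m : ℕ} (hm : 1 ≤ m) (hmin : ∀ a ∈ Λ, a ≠ 0 → m ≤ supNorm a) (c c' : Fin 3 → ℤ) :
    {n | n ∈ latticePts S 0 ∧ n - c ∈ Λ}.ncard ≤
      {n | n ∈ latticePts S 0 ∧ n - c' ∈ Λ}.ncard + cosetError k W m := by
  obtain ⟨b, hb, hred⟩ := exists_reduced_spans Λ
  obtain ⟨hli, htop⟩ := hb.linearIndependent hN hΛ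
  have hb0 : ∀ j, b j ≠ 0 := by
    intro j h
    apply hli.ne_zero j
    show eucl (b j) = 0
    rw [h]; ext; simp [eucl]
  have hbΛ : ∀ j, b j ∈ Λ := fun j => (hb _).2 ⟨Pi.single j 1, by
    simp [Pi.single_apply]⟩
  set comb : (Fin 3 → ℝ) → (Fin 3 → ℝ) := fun x => ∑ j, x j • castVec (b j) with hcomb
  have hcombE : ∀ x, (WithLp.toLp 2 (comb x) : EuclideanSpace ℝ (Fin 3)) =
      ∑ j, x j • eucl (b j) := by
    intro x; ext i; simp [hcomb, eucl, Fin.sum_univ_three]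
  have hadd : ∀ x y, comb (x + y) = comb x + comb y := by
    intro x y; simp [hcomb, add_smul, Finset.sum_add_distrib]
  have hsub : ∀ x y, comb (x - y) = comb x - comb y := by
    intro x y; simp [hcomb, sub_smul, Finset.sum_sub_distrib]
  have hcast : ∀ x : Fin 3 → ℤ, comb (castVec x) = castVec (∑ j, x j • b j) := by
    intro x; ext i; simp [hcomb, Fin.sum_univ_three]
  have hinj : Function.Injective comb := by
    intro x y hxy
    have h0 : ∑ j, (x - y) j • eucl (b j) = 0 := by rw [← hcombE, hsub, hxy, sub_self]; rfl
    have := Fintype.linearIndependent_iff.1 hli _ h0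
    ext j
    have := this j
    simpa [sub_eq_zero] using this
  -- In coordinates for the reduced basis `Λ` becomes `ℤ³`. Axis lines of `T` are lines of `S` in
  -- the directions `b i`, hence the need for arbitrary directions.
  set T : Set (Fin 3 → ℝ) := {x | castVec c + comb x ∈ S} with hT
  have hTW : SpreadLE T (54 * W / m + 1) := by
    intro x hx y hy i
    have hd : ∀ l, |comb (x - y) l| ≤ W := by
      intro l
      have h1 := hW _ hx _ hy l
      have h2 := hW _ hy _ hx l
      rw [hsub, abs_le]
      simp only [Pi.add_apply, Pi.sub_apply] at h1 h2 ⊢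
      constructor <;> linarith
    -- The factor `2` here times the `27` of the reduced basis gives the `54` in `cosetError`.
    have h3 := norm_toLp_le (Nat.cast_nonneg W) hd
    rw [hcombE] at h3
    have h4 := hred (x - y) i
    have h5 : (m : ℝ) ≤ ‖eucl (b i)‖ :=
      le_trans (by exact_mod_cast hmin _ (hbΛ i) (hb0 i)) (supNorm_le_norm_eucl (b i))
    have h6 : |(x - y) i| * m ≤ 54 * W := by
      have := mul_le_mul_of_nonneg_left h5 (abs_nonneg ((x - y) i))
      linarith
    have hm0 : (0 : ℝ) < m := by exact_mod_cast hm
    have h7 : |(x - y) i| ≤ (54 * W : ℝ) / m := by rwa [le_div_iff₀ hm0]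
    have h8 : (54 * W : ℝ) / m ≤ ((54 * W / m + 1 : ℕ) : ℝ) := by
      rw [div_le_iff₀ hm0]
      have := Nat.lt_div_mul_add (a := 54 * W) (b := m) hm
      have h9 : 54 * W ≤ (54 * W / m + 1) * m := by rw [add_mul, one_mul]; omega
      exact_mod_cast h9
    exact (le_abs_self _).trans (h7.trans h8)
  have hTn : AxisNice T k := by
    intro i p
    have hne : castVec (b i) ≠ 0 := by
      intro h
      apply hb0 i
      apply castVec_injective
      rw [h, castVec_zero]
    obtain ⟨I, hI, hIS⟩ := hS (castVec (b i)) hne (castVec c + comb p)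
    refine ⟨I, hI, ?_⟩
    rw [← hIS]
    ext t
    have : castVec c + comb (p + t • Pi.single i 1) =
        castVec c + comb p + t • castVec (b i) := by
      rw [hadd, add_assoc]
      congr 2
      simp [hcomb, Pi.single_apply]
    show castVec c + comb (p + t • Pi.single i 1) ∈ S ↔ _
    rw [this]; rfl
  have hcount : ∀ (c₁ : Fin 3 → ℤ) (t : Fin 3 → ℝ), castVec c₁ = castVec c + comb t →
      {n | n ∈ latticePts S 0 ∧ n - c₁ ∈ Λ}.ncard = (latticePts T t).ncard := by
    intro c₁ t ht
    symm
    have hx : ∀ x : Fin 3 → ℤ, castVec c + comb (castVec x + t) =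
        castVec (c₁ + ∑ j, x j • b j) := by
      intro x; rw [hadd, hcast, castVec_add, ht]; abel
    refine Set.ncard_congr (fun x _ => c₁ + ∑ j, x j • b j) ?_ ?_ ?_
    · intro x hxT
      refine ⟨?_, ?_⟩
      · show castVec (c₁ + ∑ j, x j • b j) + 0 ∈ S
        rw [add_zero, ← hx]; exact hxT
      · rw [add_sub_cancel_left]; exact (hb _).2 ⟨x, rfl⟩
    · intro x y _ _ hxy
      apply castVec_injective
      apply hinj
      rw [hcast, hcast]
      exact congrArg castVec (add_left_cancel hxy)
    · rintro n ⟨hnS, hn⟩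
      obtain ⟨x, hxn⟩ := (hb _).1 hn
      have hn' : c₁ + ∑ j, x j • b j = n := by rw [← hxn]; abel
      refine ⟨x, ?_, hn'⟩
      show castVec c + comb (castVec x + t) ∈ S
      rw [hx, hn', ← add_zero (castVec n)]; exact hnS
  -- Changing the coset is a translation by a real vector `t` in the new coordinates, so the
  -- translation bound for `ℤ³` applies.
  obtain ⟨t, ht⟩ : ∃ t, castVec c' = castVec c + comb t := by
    have : eucl (c' - c) ∈ Submodule.span ℝ (Set.range fun j => eucl (b j)) := by
      rw [htop]; exact Submodule.mem_top
    obtain ⟨t, ht⟩ := (Submodule.mem_span_range_iff_exists_fun ℝ).1 this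
    refine ⟨t, ?_⟩
    have h1 : comb t = castVec (c' - c) := by
      rw [← hcombE] at ht
      exact WithLp.toLp_injective 2 ht
    rw [h1, castVec_sub]; abel
  rw [hcount c 0 (by simp [hcomb]), hcount c' t ht]
  exact ncard_latticePts_le_translate hTW hTn 0 t

/-- A count that hardly depends on the coset is close to its average over all cosets. -/
theorem abs_ncard_coset_sub_average_le {A : Set (Fin 3 → ℤ)} (hA : A.Finite)
    {Λ : AddSubgroup (Fin 3 → ℤ)} (hΛ : Λ.index ≠ 0) {E : ℕ}
    (h : ∀ c c', {n | n ∈ A ∧ n - c ∈ Λ}.ncard ≤ {n | n ∈ A ∧ n - c' ∈ Λ}.ncard + E)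
    (c : Fin 3 → ℤ) :
    |({n | n ∈ A ∧ n - c ∈ Λ}.ncard : ℝ) - A.ncard / Λ.index| ≤ E := by
  classical
  have : Λ.FiniteIndex := ⟨hΛ⟩
  let _ : Fintype ((Fin 3 → ℤ) ⧸ Λ) := Λ.fintypeQuotientOfFiniteIndex
  have hcard : (Finset.univ : Finset ((Fin 3 → ℤ) ⧸ Λ)).card = Λ.index := by
    rw [Finset.card_univ, ← Nat.card_eq_fintype_card]; rfl
  have hsum := Finset.card_eq_sum_card_fiberwise (s := hA.toFinset)
    (f := (QuotientAddGroup.mk : (Fin 3 → ℤ) → (Fin 3 → ℤ) ⧸ Λ)) (t := Finset.univ)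
    (fun _ _ => Finset.mem_coe.2 (Finset.mem_univ _))
  have hfib : ∀ c' : Fin 3 → ℤ, (hA.toFinset.filter fun n =>
      (QuotientAddGroup.mk n : (Fin 3 → ℤ) ⧸ Λ) = QuotientAddGroup.mk c').card =
      {n | n ∈ A ∧ n - c' ∈ Λ}.ncard := by
    intro c'
    rw [← Set.ncard_coe_finset]
    congr 1
    ext n
    simp only [Finset.coe_filter, Set.Finite.mem_toFinset, Set.mem_ofPred_eq]
    rw [eq_comm, QuotientAddGroup.eq, neg_add_eq_sub]
  have hup : ∀ Q : (Fin 3 → ℤ) ⧸ Λ, ((hA.toFinset.filter fun n =>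
      (QuotientAddGroup.mk n : (Fin 3 → ℤ) ⧸ Λ) = Q).card : ℝ) ≤
      {n | n ∈ A ∧ n - c ∈ Λ}.ncard + E := by
    intro Q
    obtain ⟨c', rfl⟩ := QuotientAddGroup.mk_surjective Q
    rw [hfib]; exact_mod_cast h c' c
  have hlo : ∀ Q : (Fin 3 → ℤ) ⧸ Λ, ({n | n ∈ A ∧ n - c ∈ Λ}.ncard : ℝ) - E ≤
      ((hA.toFinset.filter fun n => (QuotientAddGroup.mk n : (Fin 3 → ℤ) ⧸ Λ) = Q).card : ℝ) := by
    intro Q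
    obtain ⟨c', rfl⟩ := QuotientAddGroup.mk_surjective Q
    rw [hfib, sub_le_iff_le_add]; exact_mod_cast h c c'
  have hsumR : (A.ncard : ℝ) = ∑ Q : (Fin 3 → ℤ) ⧸ Λ, ((hA.toFinset.filter fun n =>
      (QuotientAddGroup.mk n : (Fin 3 → ℤ) ⧸ Λ) = Q).card : ℝ) := by
    rw [Set.ncard_eq_toFinset_card _ hA, hsum]; push_cast; rfl
  have h1 := Finset.sum_le_sum fun Q (_ : Q ∈ Finset.univ) => hup Q
  have h2 := Finset.sum_le_sum fun Q (_ : Q ∈ Finset.univ) => hlo Q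
  rw [← hsumR, Finset.sum_const, nsmul_eq_mul, hcard] at h1 h2
  have hpos : (0 : ℝ) < Λ.index := by exact_mod_cast Nat.pos_of_ne_zero hΛ
  have h3 : (A.ncard : ℝ) / Λ.index ≤ {n | n ∈ A ∧ n - c ∈ Λ}.ncard + E := by
    rw [div_le_iff₀ hpos]; linarith
  have h4 : ({n | n ∈ A ∧ n - c ∈ Λ}.ncard : ℝ) - E ≤ (A.ncard : ℝ) / Λ.index := by
    rw [le_div_iff₀ hpos]; linarith
  rw [abs_le]
  constructor <;> linarith

/-! ### Averages of coset counts over cubes, for regions nice along the axes. -/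

/-- The number of elements of `A` in the coset `c + Λ`. -/
def cosetCount (Λ : AddSubgroup (Fin 3 → ℤ)) (A : Set (Fin 3 → ℤ)) (c : Fin 3 → ℤ) : ℕ :=
  {n | n ∈ A ∧ n - c ∈ Λ}.ncard

/-- The box `{0, …, L - 1}³`. -/
def cube (L : ℕ) : Finset (Fin 3 → ℤ) := Fintype.piFinset fun _ => Finset.Ico (0 : ℤ) L

/-- The elements of `A` that leave `A` under translation by `v`. -/
def leaving (A : Set (Fin 3 → ℤ)) (v : Fin 3 → ℤ) : Set (Fin 3 → ℤ) := {n | n ∈ A ∧ n + v ∉ A}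

/-- The elements outside `A` that enter `A` under translation by `v`. -/
def entering (A : Set (Fin 3 → ℤ)) (v : Fin 3 → ℤ) : Set (Fin 3 → ℤ) := {n | n + v ∈ A ∧ n ∉ A}

/-- The average of the coset counts over a box of translates. -/
def boxAvg (Λ : AddSubgroup (Fin 3 → ℤ)) (A : Set (Fin 3 → ℤ)) (L : ℕ) (c : Fin 3 → ℤ) : ℝ :=
  (∑ w ∈ cube L, (cosetCount Λ A (c + w) : ℝ)) / (L : ℝ) ^ 3

theorem card_cube (L : ℕ) : (cube L).card = L ^ 3 := by
  simp [cube, Fintype.card_piFinset]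

theorem finite_preimage_add {A : Set (Fin 3 → ℤ)} (hA : A.Finite) (v : Fin 3 → ℤ) :
    {n | n + v ∈ A}.Finite :=
  hA.preimage (add_left_injective v).injOn

theorem finite_leaving {A : Set (Fin 3 → ℤ)} (hA : A.Finite) (v : Fin 3 → ℤ) :
    (leaving A v).Finite := hA.subset fun _ h => h.1

theorem finite_entering {A : Set (Fin 3 → ℤ)} (hA : A.Finite) (v : Fin 3 → ℤ) :
    (entering A v).Finite := (finite_preimage_add hA v).subset fun _ h => h.1

theorem cosetCount_translate (Λ : AddSubgroup (Fin 3 → ℤ)) (A : Set (Fin 3 → ℤ))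
    (c v : Fin 3 → ℤ) : cosetCount Λ A (c + v) = cosetCount Λ {n | n + v ∈ A} c := by
  symm
  refine Set.ncard_congr (fun n _ => n + v) ?_ ?_ ?_
  · rintro n ⟨h1, h2⟩
    refine ⟨h1, ?_⟩
    convert h2 using 1; abel
  · intro a b _ _ h; exact add_right_cancel h
  · rintro n ⟨h1, h2⟩
    refine ⟨n - v, ⟨?_, ?_⟩, by simp⟩
    · simpa using h1
    · convert h2 using 1; abel

theorem ncard_exchange {P Q : Set (Fin 3 → ℤ)} (hP : P.Finite) (hQ : Q.Finite) :
    P.ncard + (Q \ P).ncard = Q.ncard + (P \ Q).ncard := by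
  have h1 := Set.ncard_sdiff_add_ncard Q P hQ hP
  have h2 := Set.ncard_sdiff_add_ncard P Q hP hQ
  rw [Set.union_comm] at h2
  omega

theorem cosetCount_exchange (Λ : AddSubgroup (Fin 3 → ℤ)) {A : Set (Fin 3 → ℤ)} (hA : A.Finite)
    (c v : Fin 3 → ℤ) : cosetCount Λ A c + cosetCount Λ (entering A v) c =
      cosetCount Λ A (c + v) + cosetCount Λ (leaving A v) c := by
  rw [cosetCount_translate]
  have h := ncard_exchange (P := {n | n ∈ A ∧ n - c ∈ Λ})
    (Q := {n | n ∈ {n | n + v ∈ A} ∧ n - c ∈ Λ}) (hA.subset fun _ h => h.1)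
    ((finite_preimage_add hA v).subset fun _ h => h.1)
  have e1 : {n | n ∈ entering A v ∧ n - c ∈ Λ} =
      {n | n ∈ {n | n + v ∈ A} ∧ n - c ∈ Λ} \ {n | n ∈ A ∧ n - c ∈ Λ} := by
    ext n
    simp only [entering, Set.mem_sdiff, Set.mem_ofPred_eq]
    tauto
  have e2 : {n | n ∈ leaving A v ∧ n - c ∈ Λ} =
      {n | n ∈ A ∧ n - c ∈ Λ} \ {n | n ∈ {n | n + v ∈ A} ∧ n - c ∈ Λ} := by
    ext n
    simp only [leaving, Set.mem_sdiff, Set.mem_ofPred_eq]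
    tauto
  simp only [cosetCount, e1, e2]
  exact h

theorem ncard_entering {A : Set (Fin 3 → ℤ)} (hA : A.Finite) (v : Fin 3 → ℤ) :
    (entering A v).ncard = (leaving A v).ncard := by
  -- For the full lattice there is one coset and the counts are cardinalities.
  have h := cosetCount_exchange ⊤ hA 0 v
  rw [cosetCount_translate] at h
  have h2 := cosetCount_translate ⊤ A 0 v
  have e : ∀ (B : Set (Fin 3 → ℤ)) (c : Fin 3 → ℤ), cosetCount ⊤ B c = B.ncard := by
    intro B c; simp [cosetCount]
  simp only [e] at h h2
  omega

/-- The sum over a box of translates, written as a sum over the counted set. -/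
theorem sum_cube_cosetCount (Λ : AddSubgroup (Fin 3 → ℤ)) {B : Set (Fin 3 → ℤ)} (hB : B.Finite)
    (L : ℕ) (c : Fin 3 → ℤ) : ∑ w ∈ cube L, cosetCount Λ B (c + w) =
      ∑ n ∈ hB.toFinset, cosetCount Λ (cube L : Set (Fin 3 → ℤ)) (n - c) := by
  classical
  have h1 : ∀ w, cosetCount Λ B (c + w) = ∑ n ∈ hB.toFinset, if n - (c + w) ∈ Λ then 1 else 0 := by
    intro w
    rw [← Finset.card_filter, cosetCount, ← Set.ncard_coe_finset]
    congr 1; ext n; simp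
  have h2 : ∀ n, cosetCount Λ (cube L : Set (Fin 3 → ℤ)) (n - c) =
      ∑ w ∈ cube L, if n - (c + w) ∈ Λ then 1 else 0 := by
    intro n
    rw [← Finset.card_filter, cosetCount, ← Set.ncard_coe_finset]
    congr 1; ext w
    simp only [Finset.coe_filter, Set.mem_ofPred_eq, Finset.mem_coe]
    have : w - (n - c) = -(n - (c + w)) := by abel
    rw [this, neg_mem_iff]
  simp only [h1, h2]
  exact Finset.sum_comm

theorem abs_sum_sub_le {α : Type*} (s : Finset α) (f : α → ℝ) {μ E : ℝ}
    (h : ∀ n, |f n - μ| ≤ E) : |∑ n ∈ s, f n - s.card * μ| ≤ s.card * E := by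
  have : ∑ n ∈ s, f n - s.card * μ = ∑ n ∈ s, (f n - μ) := by
    rw [Finset.sum_sub_distrib]; simp
  rw [this]
  refine (Finset.abs_sum_le_sum_abs _ _).trans ?_
  refine (Finset.sum_le_sum fun n _ => h n).trans ?_
  simp

/-- Interchanging the sums lets each point of `A` see a whole cube of translates, so only
equidistribution of the cube matters and `A` may be arbitrary. -/
theorem abs_boxAvg_sub_le {Λ : AddSubgroup (Fin 3 → ℤ)} {A : Set (Fin 3 → ℤ)} (hA : A.Finite)
    {L : ℕ} (hL : 1 ≤ L) {E d : ℝ}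
    (hE : ∀ z, |(cosetCount Λ (cube L : Set (Fin 3 → ℤ)) z : ℝ) - (L : ℝ) ^ 3 / d| ≤ E)
    (c : Fin 3 → ℤ) : |boxAvg Λ A L c - A.ncard / d| ≤ A.ncard * E / (L : ℝ) ^ 3 := by
  have hL3 : (0 : ℝ) < (L : ℝ) ^ 3 := by positivity
  have h1 : boxAvg Λ A L c - A.ncard / d = (∑ n ∈ hA.toFinset,
      (cosetCount Λ (cube L : Set (Fin 3 → ℤ)) (n - c) : ℝ) -
        hA.toFinset.card * ((L : ℝ) ^ 3 / d)) / (L : ℝ) ^ 3 := by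
    have h0 := sum_cube_cosetCount Λ hA L c
    have h0' : ∑ w ∈ cube L, (cosetCount Λ A (c + w) : ℝ) = ∑ n ∈ hA.toFinset,
      (cosetCount Λ (cube L : Set (Fin 3 → ℤ)) (n - c) : ℝ) := by exact_mod_cast h0
    rw [boxAvg, h0', sub_div, ← Set.ncard_eq_toFinset_card A hA]
    congr 1
    field_simp
  rw [h1, abs_div, abs_of_pos hL3, Set.ncard_eq_toFinset_card A hA]
  gcongr
  exact abs_sum_sub_le _ _ fun n => hE (n - c)

/-- A translation replaces the leaving points by the entering ones. These sets have equal size, so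
their expected contributions cancel and only the equidistribution errors of the cube remain. -/
theorem abs_boxAvg_sub_translate_le {Λ : AddSubgroup (Fin 3 → ℤ)} {A : Set (Fin 3 → ℤ)}
    (hA : A.Finite) {L : ℕ} (hL : 1 ≤ L) {E d : ℝ}
    (hE : ∀ z, |(cosetCount Λ (cube L : Set (Fin 3 → ℤ)) z : ℝ) - (L : ℝ) ^ 3 / d| ≤ E)
    (c v : Fin 3 → ℤ) : |boxAvg Λ A L c - boxAvg Λ A L (c + v)| ≤
      2 * (leaving A v).ncard * E / (L : ℝ) ^ 3 := by
  have h1 := abs_boxAvg_sub_le (finite_leaving hA v) hL hE c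
  have h2 := abs_boxAvg_sub_le (finite_entering hA v) hL hE c
  rw [ncard_entering hA] at h2
  have h3 : boxAvg Λ A L c - boxAvg Λ A L (c + v) =
      boxAvg Λ (leaving A v) L c - boxAvg Λ (entering A v) L c := by
    simp only [boxAvg, ← sub_div, ← Finset.sum_sub_distrib]
    congr 1
    refine Finset.sum_congr rfl fun w _ => ?_
    have := cosetCount_exchange Λ hA (c + w) v
    have h : (cosetCount Λ A (c + w) : ℝ) + cosetCount Λ (entering A v) (c + w) =
      cosetCount Λ A (c + w + v) + cosetCount Λ (leaving A v) (c + w) := by exact_mod_cast this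
    rw [add_right_comm c v w]
    linarith
  rw [h3]
  rw [abs_le] at h1 h2 ⊢
  have : 2 * ((leaving A v).ncard : ℝ) * E / (L : ℝ) ^ 3 =
    (leaving A v).ncard * E / (L : ℝ) ^ 3 + (leaving A v).ncard * E / (L : ℝ) ^ 3 := by ring
  constructor <;> linarith [h1.1, h1.2, h2.1, h2.2]

/-- Averaging the `L`-average over the `L'`-cube is the same as averaging the `L'`-average over the
`L`-cube. Each single average is close to this double average by the translation bound. -/
theorem abs_boxAvg_sub_boxAvg_le {Λ : AddSubgroup (Fin 3 → ℤ)} {A : Set (Fin 3 → ℤ)}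
    (hA : A.Finite) {L L' : ℕ} (hL : 1 ≤ L) (hL' : 1 ≤ L') {E E' d M M' : ℝ} (hE0 : 0 ≤ E)
    (hE0' : 0 ≤ E')
    (hE : ∀ z, |(cosetCount Λ (cube L : Set (Fin 3 → ℤ)) z : ℝ) - (L : ℝ) ^ 3 / d| ≤ E)
    (hE' : ∀ z, |(cosetCount Λ (cube L' : Set (Fin 3 → ℤ)) z : ℝ) - (L' : ℝ) ^ 3 / d| ≤ E')
    (hM : ∀ v ∈ cube L, ((leaving A v).ncard : ℝ) ≤ M)
    (hM' : ∀ v ∈ cube L', ((leaving A v).ncard : ℝ) ≤ M') (c : Fin 3 → ℤ) :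
    |boxAvg Λ A L c - boxAvg Λ A L' c| ≤
      2 * M' * E / (L : ℝ) ^ 3 + 2 * M * E' / (L' : ℝ) ^ 3 := by
  have gen : ∀ {L L' : ℕ}, 1 ≤ L → 1 ≤ L' → ∀ {E M' : ℝ}, 0 ≤ E →
      (∀ z, |(cosetCount Λ (cube L : Set (Fin 3 → ℤ)) z : ℝ) - (L : ℝ) ^ 3 / d| ≤ E) →
      (∀ v ∈ cube L', ((leaving A v).ncard : ℝ) ≤ M') →
      |boxAvg Λ A L c - (∑ v ∈ cube L', boxAvg Λ A L (c + v)) / (L' : ℝ) ^ 3| ≤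
        2 * M' * E / (L : ℝ) ^ 3 := by
    intro L L' hL hL' E M' hE0 hE hM'
    have hL3 : (0 : ℝ) < (L' : ℝ) ^ 3 := by positivity
    have h1 : boxAvg Λ A L c - (∑ v ∈ cube L', boxAvg Λ A L (c + v)) / (L' : ℝ) ^ 3 =
        (∑ v ∈ cube L', (boxAvg Λ A L c - boxAvg Λ A L (c + v))) / (L' : ℝ) ^ 3 := by
      rw [Finset.sum_sub_distrib, Finset.sum_const, card_cube, sub_div, nsmul_eq_mul]
      push_cast
      field_simp
    rw [h1, abs_div, abs_of_pos hL3, div_le_iff₀ hL3]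
    refine (Finset.abs_sum_le_sum_abs _ _).trans ?_
    have h2 : ∀ v ∈ cube L', |boxAvg Λ A L c - boxAvg Λ A L (c + v)| ≤
        2 * M' * E / (L : ℝ) ^ 3 := by
      intro v hv
      refine (abs_boxAvg_sub_translate_le hA hL hE c v).trans ?_
      have := hM' v hv
      gcongr
    refine (Finset.sum_le_sum h2).trans ?_
    rw [Finset.sum_const, card_cube, nsmul_eq_mul]
    push_cast
    rw [mul_comm]
  have h1 := gen hL hL' hE0 hE hM'
  have h2 := gen hL' hL hE0' hE' hM
  have h3 : (∑ v ∈ cube L', boxAvg Λ A L (c + v)) / (L' : ℝ) ^ 3 =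
      (∑ v ∈ cube L, boxAvg Λ A L' (c + v)) / (L : ℝ) ^ 3 := by
    simp only [boxAvg, ← Finset.sum_div, div_div]
    rw [Finset.sum_comm, mul_comm ((L : ℝ) ^ 3)]
    congr 1
    refine Finset.sum_congr rfl fun w _ => Finset.sum_congr rfl fun v _ => ?_
    rw [add_right_comm]
  rw [h3] at h1
  rw [abs_le] at h1 h2 ⊢
  constructor <;> linarith [h1.1, h1.2, h2.1, h2.2]

/-- This boundary term is left unestimated: for one lattice no adequate bound is claimed, and the
gain comes from the later sum over ideals. -/
theorem abs_cosetCount_sub_boxAvg_le (Λ : AddSubgroup (Fin 3 → ℤ)) {A : Set (Fin 3 → ℤ)}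
    (hA : A.Finite) {L : ℕ} (hL : 1 ≤ L) (c : Fin 3 → ℤ) :
    |(cosetCount Λ A c : ℝ) - boxAvg Λ A L c| ≤ (∑ w ∈ cube L,
      ((cosetCount Λ (leaving A w) c : ℝ) + cosetCount Λ (entering A w) c)) / (L : ℝ) ^ 3 := by
  have hL3 : (0 : ℝ) < (L : ℝ) ^ 3 := by positivity
  have h1 : (cosetCount Λ A c : ℝ) - boxAvg Λ A L c =
      (∑ w ∈ cube L, ((cosetCount Λ A c : ℝ) - cosetCount Λ A (c + w))) / (L : ℝ) ^ 3 := by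
    rw [Finset.sum_sub_distrib, Finset.sum_const, card_cube, sub_div, nsmul_eq_mul, boxAvg]
    push_cast
    field_simp
  rw [h1, abs_div, abs_of_pos hL3]
  gcongr
  refine (Finset.abs_sum_le_sum_abs _ _).trans (Finset.sum_le_sum fun w _ => ?_)
  have := cosetCount_exchange Λ hA c w
  have h : (cosetCount Λ A c : ℝ) + cosetCount Λ (entering A w) c =
      cosetCount Λ A (c + w) + cosetCount Λ (leaving A w) c := by exact_mod_cast this
  have p1 : (0 : ℝ) ≤ cosetCount Λ (entering A w) c := Nat.cast_nonneg _
  have p2 : (0 : ℝ) ≤ cosetCount Λ (leaving A w) c := Nat.cast_nonneg _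
  rw [abs_le]
  constructor <;> linarith

/-- Each unit step along an axis expels at most `k(2W+1)²` further points. -/
theorem ncard_leaving_add_axis_le {S : Set (Fin 3 → ℝ)} {W k : ℕ} (hW : SpreadLE S W)
    (hS : AxisNice S k) (v : Fin 3 → ℤ) (i : Fin 3) (j : ℕ) :
    (leaving (latticePts S 0) (v + j • Pi.single i 1)).ncard ≤
      (leaving (latticePts S 0) v).ncard + j * (k * (2 * W + 1) ^ 2) := by
  have hA := finite_latticePts hW 0
  induction j with
  | zero => simp
  | succ j ih =>
    set v' := v + j • (Pi.single i 1 : Fin 3 → ℤ) with hv'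
    set Q := {n | n ∈ latticePts S 0 ∧ n ∉ latticePts S (0 + (1 : ℝ) • Pi.single i 1)} with hQ
    have hQfin : Q.Finite := hA.subset fun n hn => hn.1
    have hsub : leaving (latticePts S 0) (v + (j + 1) • Pi.single i 1) ⊆
        leaving (latticePts S 0) v' ∪ {n | n + v' ∈ Q} := by
      rintro n ⟨h1, h2⟩
      by_cases h : n + v' ∈ latticePts S 0
      · right
        refine ⟨h, fun h3 => h2 ?_⟩
        have e : castVec (n + (v + (j + 1) • (Pi.single i 1 : Fin 3 → ℤ))) =
            castVec (n + v') + (1 : ℝ) • Pi.single i 1 := by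
          ext l
          by_cases hl : l = i
          · subst hl; simp [hv']; ring
          · simp [hv', hl]
        show castVec _ + 0 ∈ S
        rw [e, add_zero]
        have h4 : castVec (n + v') + (0 + (1 : ℝ) • Pi.single i 1) ∈ S := h3
        rwa [zero_add] at h4
      · exact Or.inl ⟨h1, h⟩
    have hc : {n | n + v' ∈ Q}.ncard ≤ Q.ncard :=
      Set.ncard_le_ncard_of_injOn (fun n => n + v') (fun n hn => hn)
        (add_left_injective v').injOn hQfin
    have hq : Q.ncard ≤ k * (2 * W + 1) ^ 2 := ncard_leaving_le hW (hS i) 0 zero_le_one le_rfl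
    have := (Set.ncard_le_ncard hsub ((finite_leaving hA v').union
      (finite_preimage_add hQfin v'))).trans (Set.ncard_union_le _ _)
    rw [add_mul, one_mul]
    omega

theorem ncard_leaving_cube_le {S : Set (Fin 3 → ℝ)} {W k : ℕ} (hW : SpreadLE S W)
    (hS : AxisNice S k) {L : ℕ} {v : Fin 3 → ℤ} (hv : v ∈ cube L) :
    (leaving (latticePts S 0) v).ncard ≤ 3 * L * (k * (2 * W + 1) ^ 2) := by
  rw [cube, Fintype.mem_piFinset] at hv
  have hv' : ∀ i, ∃ j : ℕ, v i = j ∧ j ≤ L := by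
    intro i
    have := Finset.mem_Ico.1 (hv i)
    exact ⟨(v i).toNat, by omega, by omega⟩
  choose j hj hjL using hv'
  have e : v = 0 + j 0 • (Pi.single 0 1 : Fin 3 → ℤ) + j 1 • (Pi.single 1 1 : Fin 3 → ℤ) +
      j 2 • (Pi.single 2 1 : Fin 3 → ℤ) := by
    ext l; fin_cases l <;> simp [hj]
  have h0 : (leaving (latticePts S 0) 0).ncard = 0 := by
    rw [Set.ncard_eq_zero (finite_leaving (finite_latticePts hW 0) 0)]
    ext n; simp [leaving]
  have h1 := ncard_leaving_add_axis_le hW hS 0 0 (j 0)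
  have h2 := ncard_leaving_add_axis_le hW hS (0 + j 0 • (Pi.single 0 1 : Fin 3 → ℤ)) 1 (j 1)
  have h3 := ncard_leaving_add_axis_le hW hS
    (0 + j 0 • (Pi.single 0 1 : Fin 3 → ℤ) + j 1 • (Pi.single 1 1 : Fin 3 → ℤ)) 2 (j 2)
  rw [← e] at h3
  have m0 := Nat.mul_le_mul_right (k * (2 * W + 1) ^ 2) (hjL 0)
  have m1 := Nat.mul_le_mul_right (k * (2 * W + 1) ^ 2) (hjL 1)
  have m2 := Nat.mul_le_mul_right (k * (2 * W + 1) ^ 2) (hjL 2)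
  have : 3 * L * (k * (2 * W + 1) ^ 2) = L * (k * (2 * W + 1) ^ 2) + L * (k * (2 * W + 1) ^ 2) +
    L * (k * (2 * W + 1) ^ 2) := by ring
  omega

theorem cosetError_le (k W : ℕ) {m : ℕ} (hm : 1 ≤ m) :
    (cosetError k W m : ℝ) ≤ 70000 * k * ((W / m : ℝ) ^ 2 + 1) := by
  have hm0 : (0 : ℝ) < m := by exact_mod_cast hm
  have h1 : ((54 * W / m : ℕ) : ℝ) ≤ 54 * (W / m : ℝ) := by
    refine Nat.cast_div_le.trans_eq ?_
    push_cast; ring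
  have h0 : (0 : ℝ) ≤ ((54 * W / m : ℕ) : ℝ) := Nat.cast_nonneg _
  rw [cosetError]
  push_cast
  set x := ((54 * W / m : ℕ) : ℝ)
  set y := (W / m : ℝ)
  have h2 : (2 * (x + 1) + 1) ^ 2 ≤ 23328 * y ^ 2 + 18 := by
    have : (2 * (x + 1) + 1) ^ 2 ≤ (108 * y + 3) ^ 2 :=
      pow_le_pow_left₀ (by positivity) (by linarith) 2
    nlinarith [sq_nonneg (108 * y - 3)]
  have hk : (0 : ℝ) ≤ k := Nat.cast_nonneg k
  have h3 := mul_le_mul_of_nonneg_left h2 hk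
  nlinarith [mul_nonneg hk (sq_nonneg y)]

/-- A cube has an almost equal number of points in each coset. -/
theorem abs_cosetCount_cube_sub_le {Λ : AddSubgroup (Fin 3 → ℤ)} {N : ℕ} (hN : N ≠ 0)
    (hΛ : ∀ a : Fin 3 → ℤ, N • a ∈ Λ) (hidx : Λ.index ≠ 0) {m : ℕ} (hm : 1 ≤ m)
    (hmin : ∀ a ∈ Λ, a ≠ 0 → m ≤ supNorm a) (L : ℕ) (z : Fin 3 → ℤ) :
    |(cosetCount Λ (cube L : Set (Fin 3 → ℤ)) z : ℝ) - (L : ℝ) ^ 3 / Λ.index| ≤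
      70000 * ((L / m : ℝ) ^ 2 + 1) := by
  set S : Set (Fin 3 → ℝ) := Set.pi Set.univ fun _ => Set.Ico (0 : ℝ) L with hS
  have hconv : Convex ℝ S := convex_pi fun _ _ => convex_Ico 0 (L : ℝ)
  have hW : SpreadLE S L := by
    intro x hx y hy i
    have h1 := (hx i trivial).2
    have h2 := (hy i trivial).1
    linarith
  have hnice : LineNice S 1 := by
    intro v _ p
    refine ⟨fun _ => {t : ℝ | p + t • v ∈ S}, fun _ => ?_, (Set.iUnion_const _).symm⟩
    have e : {t : ℝ | p + t • v ∈ S} = (AffineMap.lineMap p (p + v) : ℝ →ᵃ[ℝ] _) ⁻¹' S := by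
      ext t
      simp [AffineMap.lineMap_apply, add_comm]
    rw [e]
    exact (hconv.affine_preimage _).ordConnected
  have hcube : latticePts S 0 = (cube L : Set (Fin 3 → ℤ)) := by
    ext n
    rw [Finset.mem_coe, cube, Fintype.mem_piFinset]
    show castVec n + 0 ∈ S ↔ _
    rw [add_zero, hS, Set.mem_univ_pi]
    refine forall_congr' fun i => ?_
    rw [Set.mem_Ico, Finset.mem_Ico, castVec_apply]
    exact and_congr (by norm_cast) (by norm_cast)
  have h := abs_ncard_coset_sub_average_le (finite_latticePts hW 0) hidx
    (ncard_coset_le hW hnice hN hΛ hm hmin) z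
  rw [hcube, Set.ncard_coe_finset, card_cube] at h
  have h2 := cosetError_le 1 L hm
  rw [Nat.cast_one, mul_one] at h2
  have h3 : ((L ^ 3 : ℕ) : ℝ) = (L : ℝ) ^ 3 := by push_cast; rfl
  rw [h3] at h
  exact h.trans h2

/-- Comparison of the count in one coset with the average over all cosets, for a set that is only
nice along the coordinate axes. -/
theorem abs_cosetCount_sub_le_of_axisNice {S : Set (Fin 3 → ℝ)} {W k : ℕ} (hW : SpreadLE S W)
    (hS : AxisNice S k) {Λ : AddSubgroup (Fin 3 → ℤ)} {N : ℕ} (hN : N ≠ 0)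
    (hΛ : ∀ a : Fin 3 → ℤ, N • a ∈ Λ) (hidx : Λ.index ≠ 0) {m : ℕ} (hm : 1 ≤ m)
    (hmin : ∀ a ∈ Λ, a ≠ 0 → m ≤ supNorm a) {L : ℕ} (hL : 1 ≤ L) (c : Fin 3 → ℤ) :
    |(cosetCount Λ (latticePts S 0) c : ℝ) - (latticePts S 0).ncard / Λ.index| ≤
      (∑ w ∈ cube L, ((cosetCount Λ (leaving (latticePts S 0) w) c : ℝ) +
        cosetCount Λ (entering (latticePts S 0) w) c)) / (L : ℝ) ^ 3 +
      Nat.clog 2 (2 * W + 1) *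
        (1050000 * (k * (2 * W + 1) ^ 2) * (1 / (m : ℝ) ^ 2 + 1 / (L : ℝ) ^ 2)) +
      70000 * ((2 * W + 1) ^ 2 / (m : ℝ) ^ 2 + 1) := by
  set A := latticePts S 0 with hAdef
  have hA : A.Finite := finite_latticePts hW 0
  set J := Nat.clog 2 (2 * W + 1) with hJ
  set K : ℝ := k * (2 * W + 1) ^ 2 with hK
  have hK0 : 0 ≤ K := by positivity
  have hm0 : (0 : ℝ) < m := by exact_mod_cast hm
  have hcube := abs_cosetCount_cube_sub_le hN hΛ hidx hm hmin
  have hleave : ∀ L' : ℕ, ∀ v ∈ cube L', ((leaving A v).ncard : ℝ) ≤ 3 * L' * K := by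
    intro L' v hv
    have := ncard_leaving_cube_le hW hS hv
    rw [hK]; exact_mod_cast this
  have hLj : ∀ j, 1 ≤ 2 ^ j * L := fun j => Nat.one_le_iff_ne_zero.2 (by positivity)
  have hstep : ∀ j, |boxAvg Λ A (2 ^ j * L) c - boxAvg Λ A (2 ^ (j + 1) * L) c| ≤
      1050000 * K * (1 / (m : ℝ) ^ 2 + 1 / (L : ℝ) ^ 2) := by
    intro j
    have h := abs_boxAvg_sub_boxAvg_le hA (hLj j) (hLj (j + 1)) (by positivity) (by positivity)
      (hcube (2 ^ j * L)) (hcube (2 ^ (j + 1) * L)) (hleave _) (hleave _) c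
    refine h.trans ?_
    have hl : (0 : ℝ) < ((2 ^ j * L : ℕ) : ℝ) := by exact_mod_cast hLj j
    have hl2 : ((2 ^ (j + 1) * L : ℕ) : ℝ) = 2 * ((2 ^ j * L : ℕ) : ℝ) := by push_cast; ring
    have hge : (L : ℝ) ≤ ((2 ^ j * L : ℕ) : ℝ) := by
      exact_mod_cast Nat.le_mul_of_pos_left L (by positivity)
    rw [hl2]
    set l := ((2 ^ j * L : ℕ) : ℝ)
    have hL0 : (0 : ℝ) < L := by exact_mod_cast hL
    -- The boundary sizes are of order `lK` and the cube error over `l³` is of order `1/(l m²) +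
    -- 1/l³`. The factor `l` cancels, so every doubling costs the same `K/m²`.
    have e1 : 2 * (3 * (2 * l) * K) * (70000 * ((l / m) ^ 2 + 1)) / l ^ 3 +
        2 * (3 * l * K) * (70000 * ((2 * l / m) ^ 2 + 1)) / (2 * l) ^ 3 =
        1050000 * K * (1 / (m : ℝ) ^ 2) + 892500 * K * (1 / l ^ 2) := by
      field_simp; ring
    have e2 : 1 / l ^ 2 ≤ 1 / (L : ℝ) ^ 2 := by gcongr
    rw [e1, mul_add]
    have e3 := mul_le_mul_of_nonneg_left e2 hK0
    have e4 : 0 ≤ K * (1 / l ^ 2) := by positivity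
    nlinarith
  have htel : ∀ j : ℕ, |boxAvg Λ A L c - boxAvg Λ A (2 ^ j * L) c| ≤
      j * (1050000 * K * (1 / (m : ℝ) ^ 2 + 1 / (L : ℝ) ^ 2)) := by
    intro j
    induction j with
    | zero => simp
    | succ j ih =>
      refine (abs_sub_le _ (boxAvg Λ A (2 ^ j * L) c) _).trans ?_
      have := hstep j
      push_cast
      linarith
  -- By the choice of `J` the cube is now wider than the region, so the crude bound `(2W+1)³` on the
  -- number of points suffices.
  have htop : |boxAvg Λ A (2 ^ J * L) c - A.ncard / Λ.index| ≤
      70000 * ((2 * W + 1) ^ 2 / (m : ℝ) ^ 2 + 1) := by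
    refine (abs_boxAvg_sub_le hA (hLj J) (hcube _) c).trans ?_
    have hl : (0 : ℝ) < ((2 ^ J * L : ℕ) : ℝ) := by exact_mod_cast hLj J
    have hge : (2 * W + 1 : ℝ) ≤ ((2 ^ J * L : ℕ) : ℝ) := by
      have h1 : 2 * W + 1 ≤ 2 ^ J := Nat.le_pow_clog (by norm_num) _
      exact_mod_cast h1.trans (Nat.le_mul_of_pos_right _ hL)
    set l := ((2 ^ J * L : ℕ) : ℝ)
    have hcard : (A.ncard : ℝ) ≤ (2 * W + 1) ^ 3 := by exact_mod_cast ncard_latticePts_le hW 0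
    set w : ℝ := 2 * W + 1 with hw
    have hw0 : 0 < w := by positivity
    have e1 : (A.ncard : ℝ) * (70000 * ((l / m) ^ 2 + 1)) / l ^ 3 ≤
        w ^ 3 * (70000 * ((l / m) ^ 2 + 1)) / l ^ 3 := by gcongr
    have e2 : w ^ 3 * (70000 * ((l / m) ^ 2 + 1)) / l ^ 3 =
        70000 * (w ^ 2 / (m : ℝ) ^ 2 * (w / l) + (w / l) ^ 3) := by field_simp
    have e3 : w / l ≤ 1 := (div_le_one hl).2 hge
    have e3' : 0 ≤ w / l := by positivity
    have e4 : (w / l) ^ 3 ≤ 1 := pow_le_one₀ e3' e3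
    have e5 : w ^ 2 / (m : ℝ) ^ 2 * (w / l) ≤ w ^ 2 / (m : ℝ) ^ 2 :=
      mul_le_of_le_one_right (by positivity) e3
    rw [e2] at e1
    linarith
  have hbot := abs_cosetCount_sub_boxAvg_le Λ hA hL c
  have h1 := htel J
  calc _ ≤ |(cosetCount Λ A c : ℝ) - boxAvg Λ A L c| +
        (|boxAvg Λ A L c - boxAvg Λ A (2 ^ J * L) c| +
          |boxAvg Λ A (2 ^ J * L) c - A.ncard / Λ.index|) := by
        refine (abs_sub_le _ (boxAvg Λ A L c) _).trans ?_
        gcongr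
        exact abs_sub_le _ _ _
    _ ≤ _ := by linarith

/-! ### The divisor bound and the number of ideals of bounded norm. -/

section Divisors

variable (K : Type*) [Field K] [NumberField K]

/-- Linear growth is beaten by exponential growth, through `1 + x ≤ exp x`. It serves both the
divisor bound and the bound for the number of dyadic scales. -/
theorem exists_succ_le_two_rpow {δ : ℝ} (hδ : 0 < δ) :
    ∃ B : ℝ, 1 ≤ B ∧ ∀ e : ℕ, (e + 1 : ℝ) ≤ B * (2 : ℝ) ^ (δ * e) := by
  have hl : 0 < δ * Real.log 2 := mul_pos hδ (Real.log_pos (by norm_num))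
  refine ⟨max 1 (1 / (δ * Real.log 2)), le_max_left _ _, fun e => ?_⟩
  set B := max 1 (1 / (δ * Real.log 2))
  have h1 : 1 + δ * Real.log 2 * e ≤ (2 : ℝ) ^ (δ * e) := by
    rw [Real.rpow_def_of_pos (by norm_num)]
    have := Real.add_one_le_exp (Real.log 2 * (δ * e))
    linarith
  have hB1 : 1 ≤ B := le_max_left _ _
  have hB2 : 1 ≤ B * (δ * Real.log 2) := by
    have : 1 / (δ * Real.log 2) ≤ B := le_max_right _ _
    rwa [div_le_iff₀ hl] at this
  have he : (0 : ℝ) ≤ e := Nat.cast_nonneg e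
  have h2 := mul_le_mul_of_nonneg_left h1 (by linarith : (0 : ℝ) ≤ B)
  nlinarith [mul_le_mul_of_nonneg_right hB2 he]

open UniqueFactorizationMonoid in
theorem ncard_dvd_le_prod [DecidableEq (Ideal (𝓞 K))] {I : Ideal (𝓞 K)} (hI : I ≠ 0) :
    {J : Ideal (𝓞 K) | J ∣ I}.ncard ≤
      ∏ p ∈ (normalizedFactors I).toFinset, ((normalizedFactors I).count p + 1) := by
  rw [← Multiset.card_Iic, ← Set.ncard_coe_finset]
  have hJ : ∀ J : Ideal (𝓞 K), J ∣ I → J ≠ 0 := fun J h h0 => hI (by rwa [h0, zero_dvd_iff] at h)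
  refine Set.ncard_le_ncard_of_injOn normalizedFactors ?_ ?_ (Finset.finite_toSet _)
  · intro J h
    rw [Finset.mem_coe, Finset.mem_Iic]
    exact (dvd_iff_normalizedFactors_le_normalizedFactors (hJ J h) hI).1 h
  · intro J h J' h' e
    have e1 := prod_normalizedFactors (hJ J h)
    have e2 := prod_normalizedFactors (hJ J' h')
    rw [e] at e1
    exact associated_iff_eq.1 (e1.symm.trans e2)

open UniqueFactorizationMonoid in
/-- The divisor bound for ideals. -/
theorem exists_ncard_dvd_le {δ : ℝ} (hδ : 0 < δ) : ∃ C : ℝ, 0 < C ∧ ∀ I : Ideal (𝓞 K), I ≠ 0 →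
    ({J : Ideal (𝓞 K) | J ∣ I}.ncard : ℝ) ≤ C * (Ideal.absNorm I : ℝ) ^ δ := by
  classical
  obtain ⟨B, hB1, hB⟩ := exists_succ_le_two_rpow hδ
  -- Primes of norm above `2^(1/δ)` satisfy `e + 1 ≤ 2^e ≤ N(p)^(δe)` with no constant. The finitely
  -- many others cost a factor `B` each.
  set M : ℕ := ⌈(2 : ℝ) ^ (1 / δ)⌉₊ with hM
  have hfin := Ideal.finite_setOfPred_absNorm_le (S := 𝓞 K) M
  set P := hfin.toFinset with hP
  refine ⟨B ^ P.card, by positivity, fun I hI => ?_⟩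
  set s := normalizedFactors I with hs
  have hprime : ∀ p ∈ s.toFinset, 2 ≤ Ideal.absNorm p := by
    intro p hp
    have hpp := prime_of_normalized_factor p (Multiset.mem_toFinset.1 hp)
    have h0 : Ideal.absNorm p ≠ 0 := fun h => hpp.ne_zero (Ideal.absNorm_eq_zero_iff.1 h)
    have h1 : Ideal.absNorm p ≠ 1 := fun h => hpp.not_isUnit
      (Ideal.isUnit_iff.2 (Ideal.absNorm_eq_one_iff.1 h))
    omega
  have hnorm : (Ideal.absNorm I : ℝ) ^ δ =
      ∏ p ∈ s.toFinset, (Ideal.absNorm p : ℝ) ^ (δ * s.count p) := by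
    have e1 : s.prod = I := associated_iff_eq.1 (prod_normalizedFactors hI)
    conv_lhs => rw [← e1, Finset.prod_multiset_count, map_prod]
    push_cast
    rw [← Real.finsetProd_rpow _ _ fun p _ => by positivity]
    refine Finset.prod_congr rfl fun p _ => ?_
    rw [map_pow]
    push_cast
    rw [← Real.rpow_natCast, ← Real.rpow_mul (Nat.cast_nonneg _), mul_comm]
  have hterm : ∀ p ∈ s.toFinset, ((s.count p : ℝ) + 1) ≤
      (if p ∈ P then B else 1) * (Ideal.absNorm p : ℝ) ^ (δ * s.count p) := by
    intro p hp
    have h2 : (2 : ℝ) ≤ Ideal.absNorm p := by exact_mod_cast hprime p hp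
    by_cases hpP : p ∈ P
    · rw [if_pos hpP]
      refine (hB _).trans ?_
      gcongr
    · rw [if_neg hpP, one_mul]
      have h3 : M < Ideal.absNorm p := by
        rw [hP, Set.Finite.mem_toFinset] at hpP
        exact not_le.1 hpP
      have h4 : (2 : ℝ) ^ (1 / δ) ≤ Ideal.absNorm p :=
        (Nat.le_ceil _).trans (by exact_mod_cast h3.le)
      have h5 : (2 : ℝ) ^ (s.count p) ≤ (Ideal.absNorm p : ℝ) ^ (δ * s.count p) := by
        calc (2 : ℝ) ^ (s.count p) = ((2 : ℝ) ^ (1 / δ)) ^ (δ * s.count p) := by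
              rw [← Real.rpow_mul (by norm_num), ← mul_assoc, one_div_mul_cancel hδ.ne', one_mul,
                Real.rpow_natCast]
          _ ≤ _ := by gcongr
      refine le_trans ?_ h5
      exact_mod_cast Nat.lt_two_pow_self
  have hB' : ∏ p ∈ s.toFinset, (if p ∈ P then B else 1) ≤ B ^ P.card := by
    rw [← Finset.prod_filter, Finset.prod_const]
    refine pow_le_pow_right₀ hB1 (Finset.card_le_card ?_)
    intro p hp
    exact (Finset.mem_filter.1 hp).2
  have h1 : ({J : Ideal (𝓞 K) | J ∣ I}.ncard : ℝ) ≤ ∏ p ∈ s.toFinset, ((s.count p : ℝ) + 1) := by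
    exact_mod_cast ncard_dvd_le_prod K hI
  refine h1.trans ((Finset.prod_le_prod (fun p _ => by positivity) hterm).trans ?_)
  rw [Finset.prod_mul_distrib, ← hnorm]
  gcongr

/-- The number of ideals of norm at most `x` is `O(x)`. -/
theorem exists_ncard_ideal_le : ∃ C : ℝ, 0 < C ∧ ∀ x : ℝ, 1 ≤ x →
    ({J : Ideal (𝓞 K) | (Ideal.absNorm J : ℝ) ≤ x}.ncard : ℝ) ≤ C * x := by
  have h := NumberField.Ideal.tendsto_norm_le_div_atTop K
  set l := (2 ^ NumberField.InfinitePlace.nrRealPlaces K * (2 * Real.pi) ^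
    NumberField.InfinitePlace.nrComplexPlaces K * NumberField.Units.regulator K *
    (NumberField.classNumber K) /
    ((NumberField.Units.torsionOrder K) * √|(NumberField.discr K : ℝ)|)) with hl
  obtain ⟨s0, hs0⟩ := Filter.eventually_atTop.1 (h.eventually_lt_const (lt_add_one l))
  have hcard : ∀ x : ℝ, Nat.card {I : Ideal (𝓞 K) // (Ideal.absNorm I : ℝ) ≤ x} =
      {J : Ideal (𝓞 K) | (Ideal.absNorm J : ℝ) ≤ x}.ncard := fun x => rfl
  simp only [hcard] at hs0
  have hfin : ∀ x : ℝ, {J : Ideal (𝓞 K) | (Ideal.absNorm J : ℝ) ≤ x}.Finite := fun x =>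
    (Ideal.finite_setOfPred_absNorm_le (S := 𝓞 K) ⌊x⌋₊).subset fun J hJ => Nat.le_floor hJ
  set c0 := (({J : Ideal (𝓞 K) | (Ideal.absNorm J : ℝ) ≤ s0}.ncard : ℕ) : ℝ)
  have hc0 : 0 ≤ c0 := Nat.cast_nonneg _
  refine ⟨|l| + 1 + c0, by positivity, fun x hx => ?_⟩
  rcases le_total s0 x with hsx | hsx
  · have h1 := hs0 x hsx
    rw [div_lt_iff₀ (by linarith)] at h1
    refine h1.le.trans ?_
    exact mul_le_mul_of_nonneg_right (by linarith [le_abs_self l]) (by linarith)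
  · have h1 : ({J : Ideal (𝓞 K) | (Ideal.absNorm J : ℝ) ≤ x}.ncard : ℝ) ≤ c0 := by
      refine Nat.cast_le.2 (Set.ncard_le_ncard (fun J hJ => ?_) (hfin s0))
      exact le_trans (show (Ideal.absNorm J : ℝ) ≤ x from hJ) hsx
    have h2 : 0 ≤ |l| := abs_nonneg l
    nlinarith

end Divisors

/-! ### The lattice of an ideal and its shortest vector. -/

section Lattice

variable {K : Type*} [Field K] [NumberField K]

/-- The map `a ↦ a₁ν₁ + a₂ν₂ + a₃ν₃` as a homomorphism. -/
def incompleteHom (ν : Fin 4 → 𝓞 K) : (Fin 3 → ℤ) →+ 𝓞 K where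
  toFun := incompleteSum ν
  map_zero' := by simp [incompleteSum]
  map_add' a b := by simp [incompleteSum, add_mul, Finset.sum_add_distrib]

/-- The lattice of all integer vectors `a` with `𝔡 ∣ (a₁ν₁ + a₂ν₂ + a₃ν₃)`. -/
def idealLattice (ν : Fin 4 → 𝓞 K) (𝔡 : Ideal (𝓞 K)) : AddSubgroup (Fin 3 → ℤ) :=
  (Submodule.toAddSubgroup 𝔡).comap (incompleteHom ν)

theorem mem_idealLattice {ν : Fin 4 → 𝓞 K} {𝔡 : Ideal (𝓞 K)} {a : Fin 3 → ℤ} :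
    a ∈ idealLattice ν 𝔡 ↔ incompleteSum ν a ∈ 𝔡 := Iff.rfl

theorem dvd_span_iff_mem_idealLattice {ν : Fin 4 → 𝓞 K} {𝔡 : Ideal (𝓞 K)} {a : Fin 3 → ℤ} :
    𝔡 ∣ Ideal.span {incompleteSum ν a} ↔ a ∈ idealLattice ν 𝔡 := by
  rw [Ideal.dvd_span_singleton, mem_idealLattice]

theorem incompleteSum_injective {ν : Fin 4 → 𝓞 K}
    (hν : LinearIndependent ℚ (fun i => (ν i : K))) : Function.Injective (incompleteSum ν) := by
  have h3 : LinearIndependent ℚ (fun i : Fin 3 => (ν i.castSucc : K)) :=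
    hν.comp _ (Fin.castSucc_injective 3)
  have hz : ∀ a, incompleteHom ν a = 0 → a = 0 := by
    intro a ha
    have h0 : ∑ i : Fin 3, (a i : ℚ) • (ν i.castSucc : K) = 0 := by
      have h1 : ((incompleteSum ν a : 𝓞 K) : K) = 0 := by
        have : incompleteSum ν a = 0 := ha
        rw [this]; simp
      rw [← h1, incompleteSum]
      simp [Algebra.smul_def]
    have := Fintype.linearIndependent_iff.1 h3 _ h0
    ext i
    have := this i
    exact_mod_cast this
  exact (injective_iff_map_eq_zero (incompleteHom ν)).2 hz

theorem absNorm_nsmul_mem_idealLattice (ν : Fin 4 → 𝓞 K) (𝔡 : Ideal (𝓞 K)) (a : Fin 3 → ℤ) :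
    Ideal.absNorm 𝔡 • a ∈ idealLattice ν 𝔡 := by
  show incompleteHom ν _ ∈ 𝔡
  rw [map_nsmul, nsmul_eq_mul]
  exact 𝔡.mul_mem_right _ (Ideal.absNorm_mem 𝔡)

theorem index_idealLattice_dvd (ν : Fin 4 → 𝓞 K) (𝔡 : Ideal (𝓞 K)) :
    (idealLattice ν 𝔡).index ∣ Ideal.absNorm 𝔡 := by
  rw [idealLattice, AddSubgroup.index_comap]
  exact AddSubgroup.relIndex_dvd_index_of_normal _ _

/-- The least maximum norm of a nonzero vector of the lattice. -/
def minNorm (Λ : AddSubgroup (Fin 3 → ℤ)) : ℕ := sInf {m | ∃ a ∈ Λ, a ≠ 0 ∧ supNorm a = m}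

theorem minNorm_le {Λ : AddSubgroup (Fin 3 → ℤ)} {a : Fin 3 → ℤ} (ha : a ∈ Λ) (h0 : a ≠ 0) :
    minNorm Λ ≤ supNorm a := Nat.sInf_le ⟨a, ha, h0, rfl⟩

theorem exists_supNorm_eq_minNorm {Λ : AddSubgroup (Fin 3 → ℤ)} {N : ℕ} (hN : N ≠ 0)
    (hΛ : ∀ a : Fin 3 → ℤ, N • a ∈ Λ) : ∃ a ∈ Λ, a ≠ 0 ∧ supNorm a = minNorm Λ := by
  have hne : {m | ∃ a ∈ Λ, a ≠ 0 ∧ supNorm a = m}.Nonempty := by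
    refine ⟨_, N • 1, hΛ 1, ?_, rfl⟩
    intro h
    have := congrFun h 0
    simp [hN] at this
  exact Nat.sInf_mem hne

theorem one_le_supNorm {a : Fin 3 → ℤ} (ha : a ≠ 0) : 1 ≤ supNorm a := by
  by_contra h
  apply ha
  ext i
  have := natAbs_le_supNorm a i
  have h0 : (a i).natAbs = 0 := by omega
  simpa using h0

/-- Pigeonhole: distinct points of a cube of side `minNorm Λ` differ by a vector of smaller sup
norm, so they lie in different cosets. -/
theorem minNorm_pow_three_le_index {Λ : AddSubgroup (Fin 3 → ℤ)} (hidx : Λ.index ≠ 0) :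
    minNorm Λ ^ 3 ≤ Λ.index := by
  classical
  have : Λ.FiniteIndex := ⟨hidx⟩
  have : Finite ((Fin 3 → ℤ) ⧸ Λ) := Λ.finite_quotient_of_finiteIndex
  rw [← card_cube, ← Set.ncard_coe_finset]
  have hidx' : Λ.index = (Set.univ : Set ((Fin 3 → ℤ) ⧸ Λ)).ncard := by
    rw [Set.ncard_univ]; rfl
  rw [hidx']
  refine Set.ncard_le_ncard_of_injOn QuotientAddGroup.mk (fun _ _ => Set.mem_univ _) ?_
    Set.finite_univ
  intro a ha b hb hab
  rw [QuotientAddGroup.eq, neg_add_eq_sub] at hab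
  by_contra hne
  have h1 := minNorm_le hab (sub_ne_zero.2 (Ne.symm hne))
  rw [Finset.mem_coe, cube, Fintype.mem_piFinset] at ha hb
  obtain ⟨i, -, hi⟩ := Finset.exists_mem_eq_sup Finset.univ Finset.univ_nonempty
    fun i => ((b - a) i).natAbs
  have h2 : supNorm (b - a) = ((b - a) i).natAbs := hi
  have h3 := Finset.mem_Ico.1 (ha i)
  have h4 := Finset.mem_Ico.1 (hb i)
  rw [h2, Pi.sub_apply] at h1
  omega

/-- The norm is the product over the complex embeddings, each of which is linear in `a`. -/
theorem exists_absNorm_span_incompleteSum_le (ν : Fin 4 → 𝓞 K) : ∃ C : ℝ, 1 ≤ C ∧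
    ∀ (H : ℝ) (a : Fin 3 → ℤ), (supNorm a : ℝ) ≤ H →
      (Ideal.absNorm (Ideal.span {incompleteSum ν a}) : ℝ) ≤ (C * H) ^ Module.finrank ℚ K := by
  set M : ℝ := 1 + ∑ σ : K →ₐ[ℚ] ℂ, ∑ i : Fin 3, ‖σ (ν i.castSucc : K)‖ with hM
  have hnn : ∀ σ : K →ₐ[ℚ] ℂ, 0 ≤ ∑ i : Fin 3, ‖σ (ν i.castSucc : K)‖ := fun σ =>
    Finset.sum_nonneg fun _ _ => norm_nonneg _
  refine ⟨M, ?_, fun H a ha => ?_⟩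
  · have := Finset.sum_nonneg fun σ (_ : σ ∈ Finset.univ) => hnn σ
    linarith
  rw [Ideal.absNorm_span_singleton]
  have hH0 : 0 ≤ H := (Nat.cast_nonneg _).trans ha
  have h1 : (((Algebra.norm ℤ (incompleteSum ν a)).natAbs : ℕ) : ℝ) =
      ∏ σ : K →ₐ[ℚ] ℂ, ‖σ (incompleteSum ν a : K)‖ := by
    rw [← norm_prod, ← Algebra.norm_eq_prod_embeddings ℚ ℂ, ← Algebra.coe_norm_int]
    simp
  rw [h1, ← AlgHom.card ℚ K ℂ, ← Finset.card_univ, ← Finset.prod_const]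
  refine Finset.prod_le_prod (fun _ _ => norm_nonneg _) fun σ _ => ?_
  have h2 : σ (incompleteSum ν a : K) = ∑ i : Fin 3, (a i : ℂ) * σ (ν i.castSucc : K) := by
    simp [incompleteSum]
  rw [h2]
  have h3 : ∑ i : Fin 3, ‖σ (ν i.castSucc : K)‖ ≤ M := by
    have := Finset.single_le_sum (fun σ _ => hnn σ) (Finset.mem_univ σ)
    linarith
  calc ‖∑ i : Fin 3, (a i : ℂ) * σ (ν i.castSucc : K)‖
      ≤ ∑ i : Fin 3, H * ‖σ (ν i.castSucc : K)‖ := by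
        refine norm_sum_le_of_le _ fun i _ => ?_
        rw [norm_mul]
        gcongr
        rw [Complex.norm_intCast]
        refine le_trans ?_ ha
        have : ((a i).natAbs : ℝ) ≤ supNorm a := by exact_mod_cast natAbs_le_supNorm a i
        rwa [Nat.cast_natAbs, Int.cast_abs] at this
    _ = H * ∑ i : Fin 3, ‖σ (ν i.castSucc : K)‖ := by rw [Finset.mul_sum]
    _ ≤ M * H := by rw [mul_comm]; gcongr

/-- A nonzero value of the incomplete form has few ideal divisors. -/
theorem exists_ncard_idealLattice_le {ν : Fin 4 → 𝓞 K}
    (hν : LinearIndependent ℚ (fun i => (ν i : K))) {δ : ℝ} (hδ : 0 < δ) :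
    ∃ C : ℝ, 0 < C ∧ ∀ (H : ℝ) (a : Fin 3 → ℤ), (supNorm a : ℝ) ≤ H → a ≠ 0 →
      {𝔡 | a ∈ idealLattice ν 𝔡}.Finite ∧
      ({𝔡 | a ∈ idealLattice ν 𝔡}.ncard : ℝ) ≤ C * H ^ δ := by
  obtain ⟨C1, hC1, h1⟩ := exists_absNorm_span_incompleteSum_le ν
  set n := Module.finrank ℚ K with hn
  have hn0 : (0 : ℝ) < n := by exact_mod_cast Module.finrank_pos
  obtain ⟨C2, hC2, h2⟩ := exists_ncard_dvd_le K (div_pos hδ hn0)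
  refine ⟨C2 * C1 ^ δ, by positivity, fun H a haH ha => ?_⟩
  have hH0 : 0 ≤ H := (Nat.cast_nonneg _).trans haH
  have hset : {𝔡 | a ∈ idealLattice ν 𝔡} = {𝔡 | 𝔡 ∣ Ideal.span {incompleteSum ν a}} := by
    ext 𝔡; exact dvd_span_iff_mem_idealLattice.symm
  have hne : Ideal.span {incompleteSum ν a} ≠ 0 := by
    rw [Ne, Ideal.zero_eq_bot, Ideal.span_singleton_eq_bot]
    intro h
    apply ha
    apply incompleteSum_injective hν
    rw [h]; simp [incompleteSum]
  rw [hset]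
  refine ⟨?_, ?_⟩
  · refine (Ideal.finite_setOfPred_absNorm_le (S := 𝓞 K)
      (Ideal.absNorm (Ideal.span {incompleteSum ν a}))).subset fun 𝔡 h𝔡 => ?_
    exact Nat.le_of_dvd (Nat.pos_of_ne_zero fun h => hne (Ideal.absNorm_eq_zero_iff.1 h))
      (map_dvd Ideal.absNorm h𝔡)
  · refine (h2 _ hne).trans ?_
    rw [mul_assoc]
    gcongr
    calc _ ≤ ((C1 * H) ^ n) ^ (δ / n) := by
          gcongr
          exact h1 H a haH
      _ = (C1 * H) ^ δ := by
          rw [← Real.rpow_natCast, ← Real.rpow_mul (by positivity), mul_div_cancel₀ _ hn0.ne']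
      _ = C1 ^ δ * H ^ δ := Real.mul_rpow (by positivity) hH0

end Lattice

/-! ### Sums of inverse squares over integer vectors. -/

section Shells

/-- The integer vectors of maximum norm at most `P`. -/
def supBall (P : ℕ) : Finset (Fin 3 → ℤ) := Fintype.piFinset fun _ => Finset.Icc (-(P : ℤ)) P

theorem mem_supBall {P : ℕ} {a : Fin 3 → ℤ} : a ∈ supBall P ↔ supNorm a ≤ P := by
  rw [supBall, Fintype.mem_piFinset, supNorm_le_iff]
  refine forall_congr' fun i => ?_
  rw [Finset.mem_Icc]
  omega

theorem card_shell_le {m : ℕ} (hm : 1 ≤ m) :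
    ((supBall m).filter fun a => supNorm a = m).card ≤ 54 * m ^ 2 := by
  classical
  set F : Fin 3 → Finset (Fin 3 → ℤ) := fun i => Fintype.piFinset fun l =>
    if l = i then {-(m : ℤ), (m : ℤ)} else Finset.Icc (-(m : ℤ)) m with hF
  have hsub : ((supBall m).filter fun a => supNorm a = m) ⊆ Finset.univ.biUnion F := by
    intro a ha
    rw [Finset.mem_filter] at ha
    obtain ⟨i, -, hi⟩ := Finset.exists_mem_eq_sup Finset.univ Finset.univ_nonempty
      fun i => (a i).natAbs
    have h2 : supNorm a = (a i).natAbs := hi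
    rw [Finset.mem_biUnion]
    refine ⟨i, Finset.mem_univ _, ?_⟩
    rw [hF, Fintype.mem_piFinset]
    intro l
    by_cases hl : l = i
    · subst hl
      simp only [if_true, Finset.mem_insert, Finset.mem_singleton]
      omega
    · rw [if_neg hl]
      exact Fintype.mem_piFinset.1 ha.1 l
  refine (Finset.card_le_card hsub).trans (Finset.card_biUnion_le.trans ?_)
  have hcard : ∀ i, (F i).card ≤ 18 * m ^ 2 := by
    intro i
    -- Uses `m ≥ 1`. Three coordinates, two signs and `(3m)²` choices for the rest give `54 m²`.
    have h1 : (Finset.Icc (-(m : ℤ)) m).card ≤ 3 * m := by rw [Int.card_Icc]; omega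
    have h2 : ({-(m : ℤ), (m : ℤ)} : Finset ℤ).card ≤ 2 := Finset.card_le_two
    have h3 := Nat.mul_le_mul h2 (Nat.mul_le_mul h1 h1)
    have h4 : 2 * (3 * m * (3 * m)) = 18 * m ^ 2 := by ring
    rw [h4] at h3
    refine le_trans (le_of_eq ?_) h3
    rw [hF, Fintype.card_piFinset, Fin.prod_univ_three]
    fin_cases i <;> simp <;> ring
  refine (Finset.sum_le_sum fun i _ => hcard i).trans ?_
  simp; ring_nf; rfl

theorem sum_inv_supNorm_sq_le (P : ℕ) :
    ∑ a ∈ (supBall P).filter fun a => a ≠ 0, (1 / (supNorm a : ℝ) ^ 2 : ℝ) ≤ 54 * (P : ℝ) := by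
  classical
  have hmaps : ∀ a ∈ (supBall P).filter fun a => a ≠ 0, supNorm a ∈ Finset.Icc 1 P := by
    intro a ha
    rw [Finset.mem_filter, mem_supBall] at ha
    exact Finset.mem_Icc.2 ⟨one_le_supNorm ha.2, ha.1⟩
  rw [← Finset.sum_fiberwise_of_maps_to hmaps]
  have hb : ∀ m ∈ Finset.Icc 1 P, ∑ a ∈ ((supBall P).filter fun a => a ≠ 0).filter
      (fun a => supNorm a = m), 1 / (supNorm a : ℝ) ^ 2 ≤ 54 := by
    intro m hm
    have hm1 := (Finset.mem_Icc.1 hm).1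
    have hm0 : (0 : ℝ) < m := by exact_mod_cast hm1
    rw [Finset.sum_congr rfl (g := fun _ => 1 / (m : ℝ) ^ 2) fun a ha => by
      rw [(Finset.mem_filter.1 ha).2], Finset.sum_const, nsmul_eq_mul, mul_one_div,
      div_le_iff₀ (by positivity)]
    have h1 : (((supBall P).filter fun a => a ≠ 0).filter fun a => supNorm a = m).card ≤
        54 * m ^ 2 := by
      refine (Finset.card_le_card fun a ha => ?_).trans (card_shell_le hm1)
      rw [Finset.mem_filter] at ha ⊢
      exact ⟨mem_supBall.2 ha.2.le, ha.2⟩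
    exact_mod_cast h1
  refine (Finset.sum_le_sum hb).trans ?_
  simp [mul_comm]

end Shells

/-! ### Summing over shortest vectors; the main term and the congruence condition. -/

section Reduction

variable {K : Type*} [Field K] [NumberField K]

theorem idealRange_pos {D : ℝ} (hD : 0 < D) {q : ℕ} {𝔡 : Ideal (𝓞 K)} (h : 𝔡 ∈ idealRange K D q) :
    D ≤ Ideal.absNorm 𝔡 ∧ (Ideal.absNorm 𝔡 : ℝ) ≤ 2 * D ∧ (Ideal.absNorm 𝔡).Coprime q ∧
      Ideal.absNorm 𝔡 ≠ 0 := by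
  obtain ⟨⟨h1, h2⟩, h3⟩ := (finite_idealRange K D q).mem_toFinset.1 h
  refine ⟨h1, h2, h3, fun h0 => ?_⟩
  rw [h0, Nat.cast_zero] at h1
  linarith

theorem index_idealLattice_ne_zero (ν : Fin 4 → 𝓞 K) {𝔡 : Ideal (𝓞 K)}
    (h : Ideal.absNorm 𝔡 ≠ 0) : (idealLattice ν 𝔡).index ≠ 0 := fun h0 =>
  h (by have := index_idealLattice_dvd ν 𝔡; rwa [h0, zero_dvd_iff] at this)

theorem one_le_minNorm (ν : Fin 4 → 𝓞 K) {𝔡 : Ideal (𝓞 K)} (h : Ideal.absNorm 𝔡 ≠ 0) :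
    1 ≤ minNorm (idealLattice ν 𝔡) := by
  obtain ⟨a, -, ha0, ham⟩ := exists_supNorm_eq_minNorm h (absNorm_nsmul_mem_idealLattice ν 𝔡)
  rw [← ham]; exact one_le_supNorm ha0

/-- Each ideal is charged to a shortest vector, of sup norm at most `(2D)^(1/3)`. By the divisor
bound a nonzero vector is charged `O(D^δ)` times, and the inverse squares of the vectors sum to
`O(D^(1/3))`. -/
theorem exists_sum_inv_minNorm_sq_le {ν : Fin 4 → 𝓞 K}
    (hν : LinearIndependent ℚ (fun i => (ν i : K))) {δ : ℝ} (hδ : 0 < δ) :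
    ∃ C : ℝ, 0 < C ∧ ∀ (D : ℝ) (q : ℕ), 1 ≤ 2 * D →
      ∑ 𝔡 ∈ idealRange K D q, 1 / (minNorm (idealLattice ν 𝔡) : ℝ) ^ 2 ≤
        C * D ^ (1 / 3 + δ) := by
  classical
  obtain ⟨C, hC, hdiv⟩ := exists_ncard_idealLattice_le hν hδ
  refine ⟨C * 54 * 2 ^ (1 / 3 + δ), by positivity, fun D q hD => ?_⟩
  have hD0 : 0 < D := by linarith
  set r : ℝ := (2 * D) ^ (1 / 3 : ℝ) with hr
  have hr1 : 1 ≤ r := Real.one_le_rpow hD (by norm_num)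
  have hr3 : r ^ 3 = 2 * D := by
    rw [hr, ← Real.rpow_natCast, ← Real.rpow_mul (by linarith)]; norm_num
  have hrD : r ≤ 2 * D := by rw [← hr3]; nlinarith [sq_nonneg r]
  set P := ⌊r⌋₊ with hP
  have hPr : (P : ℝ) ≤ r := Nat.floor_le (by linarith)
  have hN0 : ∀ 𝔡 ∈ idealRange K D q, Ideal.absNorm 𝔡 ≠ 0 := fun 𝔡 h =>
    (idealRange_pos hD0 h).2.2.2
  have hshort : ∀ 𝔡 ∈ idealRange K D q, ∃ a ∈ (supBall P).filter fun a => a ≠ 0,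
      a ∈ idealLattice ν 𝔡 ∧ supNorm a = minNorm (idealLattice ν 𝔡) := by
    intro 𝔡 h
    obtain ⟨a, haΛ, ha0, ham⟩ := exists_supNorm_eq_minNorm (hN0 𝔡 h)
      (absNorm_nsmul_mem_idealLattice ν 𝔡)
    refine ⟨a, Finset.mem_filter.2 ⟨mem_supBall.2 (Nat.le_floor ?_), ha0⟩, haΛ, ham⟩
    have h1 := minNorm_pow_three_le_index (index_idealLattice_ne_zero ν (hN0 𝔡 h))
    have h2 := Nat.le_of_dvd (Nat.pos_of_ne_zero (hN0 𝔡 h)) (index_idealLattice_dvd ν 𝔡)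
    have h3 : (supNorm a : ℝ) ^ 3 ≤ r ^ 3 := by
      rw [hr3, ham]
      refine le_trans ?_ (idealRange_pos hD0 h).2.1
      exact_mod_cast h1.trans h2
    exact le_of_pow_le_pow_left₀ (by norm_num) (by linarith) h3
  have step1 : ∑ 𝔡 ∈ idealRange K D q, 1 / (minNorm (idealLattice ν 𝔡) : ℝ) ^ 2 ≤
      ∑ 𝔡 ∈ idealRange K D q, ∑ a ∈ (supBall P).filter fun a => a ≠ 0,
        if a ∈ idealLattice ν 𝔡 then 1 / (supNorm a : ℝ) ^ 2 else 0 := by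
    refine Finset.sum_le_sum fun 𝔡 h => ?_
    obtain ⟨a, ha, haΛ, ham⟩ := hshort 𝔡 h
    have := Finset.single_le_sum (f := fun a => if a ∈ idealLattice ν 𝔡 then
      1 / (supNorm a : ℝ) ^ 2 else 0) (fun a _ => by split_ifs <;> positivity) ha
    simpa only [if_pos haΛ, ham] using this
  have step2 : ∀ a ∈ (supBall P).filter fun a => a ≠ 0, (∑ 𝔡 ∈ idealRange K D q,
      if a ∈ idealLattice ν 𝔡 then 1 / (supNorm a : ℝ) ^ 2 else 0) ≤
      C * (2 * D) ^ δ * (1 / (supNorm a : ℝ) ^ 2) := by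
    intro a ha
    rw [Finset.mem_filter, mem_supBall] at ha
    have haH : (supNorm a : ℝ) ≤ 2 * D :=
      le_trans (by exact_mod_cast ha.1) (hPr.trans hrD)
    obtain ⟨hfin, hle⟩ := hdiv (2 * D) a haH ha.2
    rw [← Finset.sum_filter, Finset.sum_const, nsmul_eq_mul]
    gcongr
    refine le_trans ?_ hle
    rw [← Set.ncard_coe_finset]
    refine Nat.cast_le.2 (Set.ncard_le_ncard (fun 𝔡 h => ?_) hfin)
    exact (Finset.mem_filter.1 (Finset.mem_coe.1 h)).2
  refine step1.trans ?_
  rw [Finset.sum_comm]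
  refine (Finset.sum_le_sum step2).trans ?_
  rw [← Finset.mul_sum]
  calc C * (2 * D) ^ δ * ∑ a ∈ (supBall P).filter fun a => a ≠ 0, 1 / (supNorm a : ℝ) ^ 2
      ≤ C * (2 * D) ^ δ * (54 * r) := by
        gcongr
        exact (sum_inv_supNorm_sq_le P).trans (by gcongr)
    _ = C * 54 * (2 * D) ^ (1 / 3 + δ) := by
        rw [Real.rpow_add (by linarith), hr]; ring
    _ = _ := by rw [Real.mul_rpow (by norm_num) hD0.le]; ring

theorem rho_div_absNorm (ν : Fin 4 → 𝓞 K) {𝔡 : Ideal (𝓞 K)} (hN : Ideal.absNorm 𝔡 ≠ 0) :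
    rho ν 𝔡 / (Ideal.absNorm 𝔡 : ℝ) = 1 / (idealLattice ν 𝔡).index := by
  set N := Ideal.absNorm 𝔡 with hNdef
  set Λ := idealLattice ν 𝔡 with hΛdef
  set B : Finset (Fin 3 → ℤ) := Fintype.piFinset fun _ => Finset.Icc (1 : ℤ) N with hB
  have hBcard : B.card = N ^ 3 := by simp [hB, Fintype.card_piFinset]
  have hN0 : (N : ℤ) ≠ 0 := by exact_mod_cast hN
  have hle : ∀ c c', {n | n ∈ (B : Set (Fin 3 → ℤ)) ∧ n - c ∈ Λ}.ncard ≤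
      {n | n ∈ (B : Set (Fin 3 → ℤ)) ∧ n - c' ∈ Λ}.ncard + 0 := by
    intro c c'
    rw [add_zero]
    -- Translate by `c' - c` and reduce modulo `N` to representatives in `{1, …, N}`. As `Λ`
    -- contains `Nℤ³`, all cosets have equally many points in the box, so the averaging error is
    -- `0`.
    refine Set.ncard_le_ncard_of_injOn
      (fun n i => (n i + (c' i - c i) - 1) % (N : ℤ) + 1) ?_ ?_
      (B.finite_toSet.subset fun _ h => h.1)
    · rintro n ⟨-, hn⟩
      refine ⟨?_, ?_⟩
      · rw [Finset.mem_coe, hB, Fintype.mem_piFinset]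
        intro i
        have h1 := Int.emod_nonneg (n i + (c' i - c i) - 1) hN0
        have h2 := Int.emod_lt_of_pos (n i + (c' i - c i) - 1) (by omega : (0 : ℤ) < N)
        rw [Finset.mem_Icc]
        omega
      · have e : (fun i => (n i + (c' i - c i) - 1) % (N : ℤ) + 1) - c' =
            (n - c) - N • fun i => (n i + (c' i - c i) - 1) / (N : ℤ) := by
          ext i
          have := Int.emod_add_mul_ediv (n i + (c' i - c i) - 1) N
          simp only [Pi.sub_apply, nsmul_eq_mul, Pi.mul_apply, Pi.natCast_apply]
          linarith
        rw [e]
        exact Λ.sub_mem hn (absNorm_nsmul_mem_idealLattice ν 𝔡 _)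
    · rintro a ⟨ha, -⟩ b ⟨hb, -⟩ hab
      rw [Finset.mem_coe, hB, Fintype.mem_piFinset] at ha hb
      ext i
      have h1 := Finset.mem_Icc.1 (ha i)
      have h2 := Finset.mem_Icc.1 (hb i)
      have h3 := congrFun hab i
      have h4 : (a i + (c' i - c i) - 1) ≡ (b i + (c' i - c i) - 1) [ZMOD N] :=
        add_right_cancel h3
      have h5 : (N : ℤ) ∣ (b i + (c' i - c i) - 1) - (a i + (c' i - c i) - 1) := h4.dvd
      have h6 : (N : ℤ) ∣ b i - a i := by convert h5 using 1; ring
      have h7 := Int.eq_zero_of_abs_lt_dvd h6 (by rw [abs_lt]; constructor <;> omega)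
      omega
  have h := abs_ncard_coset_sub_average_le B.finite_toSet (index_idealLattice_ne_zero ν hN) hle 0
  rw [Nat.cast_zero, abs_nonpos_iff, sub_eq_zero, Set.ncard_coe_finset, hBcard] at h
  have hset : {a : Fin 3 → ℤ | (∀ i, 1 ≤ a i ∧ a i ≤ (N : ℤ)) ∧
      𝔡 ∣ Ideal.span {incompleteSum ν a}} = {n | n ∈ (B : Set (Fin 3 → ℤ)) ∧ n - 0 ∈ Λ} := by
    ext a
    simp only [Set.mem_ofPred_eq, dvd_span_iff_mem_idealLattice, sub_zero, hB, Finset.mem_coe,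
      Fintype.mem_piFinset, Finset.mem_Icc]
    rfl
  rw [rho, ← hNdef, hset, h]
  have hNr : (N : ℝ) ≠ 0 := by exact_mod_cast hN
  push_cast
  field_simp
  rfl

/-- The region in terms of `n`, where `a = u + q n`. -/
def rescale (R : Set (Fin 3 → ℝ)) (u : Fin 3 → ℤ) (q : ℕ) : Set (Fin 3 → ℝ) :=
  {x | castVec u + (q : ℝ) • x ∈ R}

/-- With `sN + tq = 1`, multiplication by `q` is invertible modulo `Λ`, since `Λ` contains `Nℤ³`.
The condition on `n` therefore describes the coset of `-t u`. -/
theorem exists_ncard_GamDvd_eq {ν : Fin 4 → 𝓞 K}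
    (hν : LinearIndependent ℚ (fun i => (ν i : K))) (R : Set (Fin 3 → ℝ)) (u : Fin 3 → ℤ) {q : ℕ}
    (hq : 1 ≤ q) {𝔡 : Ideal (𝓞 K)} (hcop : (Ideal.absNorm 𝔡).Coprime q) : ∃ c : Fin 3 → ℤ,
    (∀ n, n - c ∈ idealLattice ν 𝔡 ↔ u + q • n ∈ idealLattice ν 𝔡) ∧
    (GamDvd ν R u q 𝔡).ncard =
      cosetCount (idealLattice ν 𝔡) (latticePts (rescale R u q) 0) c := by
  set N := Ideal.absNorm 𝔡
  set Λ := idealLattice ν 𝔡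
  have hΛ : ∀ a, N • a ∈ Λ := absNorm_nsmul_mem_idealLattice ν 𝔡
  obtain ⟨s, t, hst⟩ := (Nat.isCoprime_iff_coprime.2 hcop)
  have hΛz : ∀ (z : ℤ) (a : Fin 3 → ℤ), (z * N) • a ∈ Λ := by
    intro z a
    rw [mul_smul, natCast_zsmul]
    exact Λ.zsmul_mem (hΛ a) z
  have hqΛ : ∀ a, q • a ∈ Λ ↔ a ∈ Λ := by
    intro a
    refine ⟨fun h => ?_, fun h => Λ.nsmul_mem h q⟩
    have e : a = (s * N) • a + t • (q • a) := by
      rw [← natCast_zsmul a q, smul_smul, ← add_smul, hst, one_smul]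
    rw [e]
    exact Λ.add_mem (hΛz s a) (Λ.zsmul_mem h t)
  have hc : ∀ n, n - (-t) • u ∈ Λ ↔ u + q • n ∈ Λ := by
    intro n
    rw [← hqΛ]
    have e : q • (n - (-t) • u) = (u + q • n) - (s * N) • u := by
      have : u = (s * N) • u + (t * q) • u := by rw [← add_smul, hst, one_smul]
      conv_rhs => rw [this]
      ext i
      simp
      ring_nf
      linear_combination (u i) * (s * N) * hst
    rw [e]
    exact ⟨fun h => by simpa using Λ.add_mem h (hΛz s u), fun h => Λ.sub_mem h (hΛz s u)⟩
  refine ⟨(-t) • u, hc, ?_⟩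
  have hcast : ∀ n : Fin 3 → ℤ, n ∈ latticePts (rescale R u q) 0 ↔
      (fun i => ((u + q • n) i : ℝ)) ∈ R := by
    intro n
    have e : castVec u + (q : ℝ) • (castVec n + 0) = fun i => ((u + q • n) i : ℝ) := by
      ext i; simp
    rw [← e]; rfl
  symm
  refine Set.ncard_congr (fun n _ => incompleteSum ν (u + q • n)) ?_ ?_ ?_
  · rintro n ⟨hnR, hn⟩
    refine ⟨⟨u + q • n, (hcast n).1 hnR, fun i => ?_, rfl⟩, ?_⟩
    · simp [Int.ModEq]
    · exact dvd_span_iff_mem_idealLattice.2 ((hc n).1 hn)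
  · intro a b _ _ hab
    have h1 := add_left_cancel (incompleteSum_injective hν hab)
    ext i
    have h2 := congrFun h1 i
    have hq0 : (q : ℤ) ≠ 0 := by exact_mod_cast (by omega : q ≠ 0)
    simpa [hq0, show q ≠ 0 by omega] using h2
  · rintro κ ⟨⟨a, haR, hau, rfl⟩, hκ⟩
    choose n hn using fun i => (hau i).symm.dvd
    have e : u + q • n = a := by
      ext i
      have := hn i
      simp only [Pi.add_apply, nsmul_eq_mul, Pi.mul_apply, Pi.natCast_apply]
      linarith
    refine ⟨n, ⟨?_, ?_⟩, by rw [e]⟩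
    · rw [hcast, e]; exact haR
    · rw [hc, e]; exact dvd_span_iff_mem_idealLattice.1 hκ

end Reduction

/-! ### Invariance of the hypotheses under the substitution `a = u + qn`. -/

section Rescale

theorem LinesMeetInIntervals.smul {R : Set (Fin 3 → ℝ)} {v : Fin 3 → ℝ} {k : ℕ}
    (h : LinesMeetInIntervals R v k) {s : ℝ} (hs : 0 ≤ s) : LinesMeetInIntervals R (s • v) k := by
  intro p
  obtain ⟨I, hI, hIR⟩ := h p
  refine ⟨fun j => (fun t => t * s) ⁻¹' I j, fun j => (hI j).preimage_mono
    fun a b hab => mul_le_mul_of_nonneg_right hab hs, ?_⟩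
  rw [← Set.preimage_iUnion, ← hIR]
  ext t
  show p + t • s • v ∈ R ↔ p + (t * s) • v ∈ R
  rw [smul_smul]

theorem LinesMeetInIntervals.rescale {R : Set (Fin 3 → ℝ)} {v : Fin 3 → ℝ} {k q : ℕ}
    (h : LinesMeetInIntervals R ((q : ℝ) • v) k) (u : Fin 3 → ℤ) :
    LinesMeetInIntervals (rescale R u q) v k := by
  intro p
  obtain ⟨I, hI, hIR⟩ := h (castVec u + (q : ℝ) • p)
  refine ⟨I, hI, ?_⟩
  rw [← hIR]
  ext t
  show castVec u + (q : ℝ) • (p + t • v) ∈ R ↔ castVec u + (q : ℝ) • p + t • (q : ℝ) • v ∈ R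
  rw [smul_add, add_assoc, smul_comm]

theorem AxisNice.rescale {R : Set (Fin 3 → ℝ)} {k : ℕ} (h : AxisNice R k) (u : Fin 3 → ℤ)
    (q : ℕ) : AxisNice (rescale R u q) k := fun i =>
  ((h i).smul (Nat.cast_nonneg q)).rescale u

theorem LineNice.rescale {R : Set (Fin 3 → ℝ)} {k : ℕ} (h : LineNice R k) (u : Fin 3 → ℤ)
    {q : ℕ} (hq : 1 ≤ q) : LineNice (rescale R u q) k := fun v hv =>
  (h _ (smul_ne_zero (by exact_mod_cast (by omega : q ≠ 0)) hv)).rescale u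

theorem LineNice.axisNice {R : Set (Fin 3 → ℝ)} {k : ℕ} (h : LineNice R k) : AxisNice R k :=
  fun i => h _ (by simp)

/-- The factor `1/q` in the true diameter is discarded, which is affordable for the claimed bounds.
-/
theorem spreadLE_rescale {R : Set (Fin 3 → ℝ)} {X : ℝ}
    (hR : R ⊆ Set.Icc (fun _ => -X) (fun _ => X)) (u : Fin 3 → ℤ) {q : ℕ} (hq : 1 ≤ q) :
    SpreadLE (rescale R u q) ⌈2 * X⌉₊ := by
  intro x hx y hy i
  have h1 := (hR hx).2 i
  have h2 := (hR hy).1 i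
  simp only [Pi.add_apply, Pi.smul_apply, smul_eq_mul] at h1 h2
  have hq1 : (1 : ℝ) ≤ q := by exact_mod_cast hq
  have h3 : (q : ℝ) * (x i - y i) ≤ 2 * X := by linarith
  refine le_trans ?_ (Nat.le_ceil (2 * X))
  by_contra hlt
  rw [not_le] at hlt
  have hX : 0 ≤ X := by
    have := (hR hx).1 i
    have := (hR hx).2 i
    simp only at *
    linarith
  nlinarith

open MeasureTheory

theorem nullMeasurableSet_rescale {R : Set (Fin 3 → ℝ)} (hR : NullMeasurableSet R volume)
    (u : Fin 3 → ℤ) {q : ℕ} (hq : 1 ≤ q) : NullMeasurableSet (rescale R u q) volume := by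
  have hq0 : (q : ℝ) ≠ 0 := by exact_mod_cast (by omega : q ≠ 0)
  have h1 := hR.preimage
    (measurePreserving_add_left volume (castVec u)).quasiMeasurePreserving
  refine h1.preimage (f := fun x => (q : ℝ) • x) ⟨measurable_const_smul _, ?_⟩
  have : Measure.map (fun x : Fin 3 → ℝ => (q : ℝ) • x) volume = _ :=
    Measure.map_addHaar_smul volume hq0
  rw [this]
  exact Measure.smul_absolutelyContinuous

theorem volume_rescale (R : Set (Fin 3 → ℝ)) (u : Fin 3 → ℤ) {q : ℕ} (hq : 1 ≤ q) :
    volume.real (rescale R u q) = volume.real R / (q : ℝ) ^ 3 := by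
  have hq0 : (q : ℝ) ≠ 0 := by exact_mod_cast (by omega : q ≠ 0)
  have h1 : rescale R u q = (fun x => (q : ℝ) • x) ⁻¹' ((fun x => castVec u + x) ⁻¹' R) := rfl
  rw [h1, Measure.real, Measure.addHaar_preimage_smul volume hq0, measure_preimage_add,
    ENNReal.toReal_mul, ENNReal.toReal_ofReal (abs_nonneg _), Measure.real]
  rw [Module.finrank_fin_fun, abs_of_nonneg (by positivity)]
  ring

end Rescale

/-! ### Sums over ideals and the case of arbitrary lines. -/

section Sums

variable {K : Type*} [Field K] [NumberField K]

theorem two_mul_ceil_add_one_le {X : ℝ} (hX : 1 ≤ X) : 2 * (⌈2 * X⌉₊ : ℝ) + 1 ≤ 7 * X := by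
  have := Nat.ceil_lt_add_one (by linarith : 0 ≤ 2 * X)
  linarith

/-- Replacing the volume by the number of lattice points. -/
theorem abs_term_le {ν : Fin 4 → 𝓞 K} (hν : LinearIndependent ℚ (fun i => (ν i : K)))
    {X D : ℝ} {k q : ℕ} (u : Fin 3 → ℤ) {R : Set (Fin 3 → ℝ)} (hX : 1 ≤ X) (hD : 0 < D)
    (hq : 1 ≤ q) (hR : R ⊆ Set.Icc (fun _ => -X) (fun _ => X))
    (hm : MeasureTheory.NullMeasurableSet R MeasureTheory.volume) (hnice : AxisNice R k)
    {𝔡 : Ideal (𝓞 K)} (h𝔡 : 𝔡 ∈ idealRange K D q) : ∃ c : Fin 3 → ℤ,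
    (∀ n, n - c ∈ idealLattice ν 𝔡 ↔ u + q • n ∈ idealLattice ν 𝔡) ∧
    |((GamDvd ν R u q 𝔡).ncard : ℝ) -
      rho ν 𝔡 * MeasureTheory.volume.real R / ((q : ℝ) ^ 3 * (Ideal.absNorm 𝔡 : ℝ))| ≤
    |(cosetCount (idealLattice ν 𝔡) (latticePts (rescale R u q) 0) c : ℝ) -
      (latticePts (rescale R u q) 0).ncard / (idealLattice ν 𝔡).index| +
      147 * k * (X ^ 2 * (1 / (minNorm (idealLattice ν 𝔡) : ℝ) ^ 2)) := by
  obtain ⟨-, -, hcop, hN⟩ := idealRange_pos hD h𝔡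
  obtain ⟨c, hc, hcount⟩ := exists_ncard_GamDvd_eq hν R u hq hcop
  refine ⟨c, hc, ?_⟩
  rw [hcount]
  have hq0 : (q : ℝ) ≠ 0 := by exact_mod_cast (by omega : q ≠ 0)
  have hmain : rho ν 𝔡 * MeasureTheory.volume.real R / ((q : ℝ) ^ 3 * (Ideal.absNorm 𝔡 : ℝ)) =
      MeasureTheory.volume.real (rescale R u q) / (idealLattice ν 𝔡).index := by
    rw [volume_rescale R u hq]
    have := rho_div_absNorm ν hN
    calc _ = (rho ν 𝔡 / (Ideal.absNorm 𝔡 : ℝ)) * (MeasureTheory.volume.real R / (q : ℝ) ^ 3) := by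
          rw [div_mul_div_comm, mul_comm ((q : ℝ) ^ 3)]
      _ = _ := by rw [this]; ring
  rw [hmain]
  set d := (idealLattice ν 𝔡).index with hd
  set m := minNorm (idealLattice ν 𝔡) with hmdef
  set A := latticePts (rescale R u q) 0
  have hd0 : d ≠ 0 := index_idealLattice_ne_zero ν hN
  have hdpos : (0 : ℝ) < d := by exact_mod_cast Nat.pos_of_ne_zero hd0
  have hm1 : 1 ≤ m := one_le_minNorm ν hN
  have hmpos : (0 : ℝ) < m := by exact_mod_cast hm1
  -- The index is traded for `m²`, so that this error joins the sum of `1/m²`.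
  have hmd : (m : ℝ) ^ 2 ≤ d := by
    have h1 : m ^ 3 ≤ d := minNorm_pow_three_le_index hd0
    have h2 : m ^ 2 ≤ m ^ 3 := Nat.pow_le_pow_right hm1 (by norm_num)
    exact_mod_cast h2.trans h1
  have hvol := abs_ncard_sub_volume_le (spreadLE_rescale hR u hq) (hnice.rescale u q)
    (nullMeasurableSet_rescale hm u hq)
  have h7 := two_mul_ceil_add_one_le hX
  have hvol' : |(A.ncard : ℝ) - MeasureTheory.volume.real (rescale R u q)| ≤ 147 * k * X ^ 2 := by
    refine hvol.trans ?_
    have : (2 * (⌈2 * X⌉₊ : ℝ) + 1) ^ 2 ≤ (7 * X) ^ 2 := by gcongr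
    have := mul_le_mul_of_nonneg_left this (Nat.cast_nonneg (α := ℝ) k)
    linarith
  refine (abs_sub_le _ ((A.ncard : ℝ) / d) _).trans ?_
  gcongr
  rw [← sub_div, abs_div, abs_of_pos hdpos]
  calc _ ≤ 147 * k * X ^ 2 / (d : ℝ) := by gcongr
    _ ≤ 147 * k * X ^ 2 / (m : ℝ) ^ 2 := by gcongr
    _ = _ := by ring

theorem exists_card_idealRange_le (K : Type*) [Field K] [NumberField K] :
    ∃ C : ℝ, 0 < C ∧ ∀ (D : ℝ) (q : ℕ), 1 ≤ 2 * D → ((idealRange K D q).card : ℝ) ≤ C * D := by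
  obtain ⟨C, hC, h⟩ := exists_ncard_ideal_le K
  refine ⟨C * 2, by positivity, fun D q hD => ?_⟩
  have h1 := h (2 * D) hD
  rw [mul_assoc]
  refine le_trans ?_ h1
  rw [← Set.ncard_coe_finset]
  refine Nat.cast_le.2 (Set.ncard_le_ncard (fun 𝔡 h𝔡 => ?_) ?_)
  · exact (idealRange_pos (by linarith) (Finset.mem_coe.1 h𝔡)).2.1
  · exact (Ideal.finite_setOfPred_absNorm_le (S := 𝓞 K) ⌊2 * D⌋₊).subset
      fun J hJ => Nat.le_floor hJ

theorem exists_typeISum_le_of_lineNice {ν : Fin 4 → 𝓞 K}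
    (hν : LinearIndependent ℚ (fun i => (ν i : K))) (k : ℕ) {ε : ℝ} (hε : 0 < ε) :
    ∃ C : ℝ, 0 < C ∧ ∀ (X D : ℝ) (q : ℕ) (u : Fin 3 → ℤ) (R : Set (Fin 3 → ℝ)),
      1 ≤ X → 1 ≤ 2 * D → 1 ≤ q → R ⊆ Set.Icc (fun _ => -X) (fun _ => X) →
      MeasureTheory.NullMeasurableSet R MeasureTheory.volume → LineNice R k →
      typeISum ν R u q D ≤ C * (X ^ 2 * D ^ (1 / 3 + ε) + D) := by
  obtain ⟨C1, hC1, h1⟩ := exists_sum_inv_minNorm_sq_le hν hε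
  obtain ⟨C2, hC2, h2⟩ := exists_card_idealRange_le K
  refine ⟨700000 * k * (C1 + C2) + 1, by positivity, fun X D q u R hX hD hq hR hm hnice => ?_⟩
  have hD0 : 0 < D := by linarith
  have h7 := two_mul_ceil_add_one_le hX
  have hterm : ∀ 𝔡 ∈ idealRange K D q, |((GamDvd ν R u q 𝔡).ncard : ℝ) -
      rho ν 𝔡 * MeasureTheory.volume.real R / ((q : ℝ) ^ 3 * (Ideal.absNorm 𝔡 : ℝ))| ≤
      700000 * k * (X ^ 2 * (1 / (minNorm (idealLattice ν 𝔡) : ℝ) ^ 2) + 1) := by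
    intro 𝔡 h𝔡
    have hN := (idealRange_pos hD0 h𝔡).2.2.2
    obtain ⟨c, -, hle⟩ := abs_term_le hν u hX hD0 hq hR hm hnice.axisNice h𝔡
    have hW := spreadLE_rescale hR u hq
    have hm1 := one_le_minNorm ν hN
    have hmain := abs_ncard_coset_sub_average_le (finite_latticePts hW 0)
      (index_idealLattice_ne_zero ν hN)
      (ncard_coset_le hW (hnice.rescale u hq) hN (absNorm_nsmul_mem_idealLattice ν 𝔡) hm1
        fun a ha h0 => minNorm_le ha h0) c
    have herr := cosetError_le k ⌈2 * X⌉₊ hm1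
    set m := minNorm (idealLattice ν 𝔡)
    have hmpos : (0 : ℝ) < m := by exact_mod_cast hm1
    have h3 : ((⌈2 * X⌉₊ : ℝ) / m) ^ 2 ≤ 9 * (X ^ 2 * (1 / (m : ℝ) ^ 2)) := by
      have e : 9 * (X ^ 2 * (1 / (m : ℝ) ^ 2)) = (3 * X / m) ^ 2 := by field_simp; ring
      have := Nat.ceil_lt_add_one (by linarith : 0 ≤ 2 * X)
      rw [e]
      gcongr
      linarith
    have hk : (0 : ℝ) ≤ k := Nat.cast_nonneg k
    have h4 := mul_le_mul_of_nonneg_left h3 hk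
    have h5 : 0 ≤ k * (X ^ 2 * (1 / (m : ℝ) ^ 2)) := by positivity
    have hmain' : |(cosetCount (idealLattice ν 𝔡) (latticePts (rescale R u q) 0) c : ℝ) -
      (latticePts (rescale R u q) 0).ncard / (idealLattice ν 𝔡).index| ≤ _ := hmain
    nlinarith
  refine (Finset.sum_le_sum hterm).trans ?_
  rw [← Finset.mul_sum, Finset.sum_add_distrib, ← Finset.mul_sum, Finset.sum_const, nsmul_eq_mul,
    mul_one]
  have e1 := mul_le_mul_of_nonneg_left (h1 D q hD) (sq_nonneg X)
  have e2 := h2 D q hD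
  set T := D ^ (1 / 3 + ε)
  have hT : 0 < T := Real.rpow_pos_of_pos hD0 _
  have hXT : 0 < X ^ 2 * T := by positivity
  calc _ ≤ 700000 * k * (C1 * (X ^ 2 * T) + C2 * D) := by
        refine mul_le_mul_of_nonneg_left ?_ (by positivity)
        linarith
    _ ≤ 700000 * k * ((C1 + C2) * (X ^ 2 * T + D)) := by
        gcongr
        nlinarith
    _ ≤ _ := by nlinarith

/-- The total number of points of a finite set in the cosets belonging to the ideals. -/
theorem exists_sum_cosetCount_le {ν : Fin 4 → 𝓞 K}
    (hν : LinearIndependent ℚ (fun i => (ν i : K))) {δ : ℝ} (hδ : 0 < δ) :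
    ∃ C : ℝ, 0 < C ∧ ∀ (H D : ℝ) (q : ℕ) (u : Fin 3 → ℤ) (B : Set (Fin 3 → ℤ))
      (c : Ideal (𝓞 K) → Fin 3 → ℤ), 1 ≤ q → 0 ≤ H → B.Finite →
      (∀ n ∈ B, (supNorm (u + q • n) : ℝ) ≤ H) →
      (∀ 𝔡 ∈ idealRange K D q, ∀ n, n - c 𝔡 ∈ idealLattice ν 𝔡 ↔ u + q • n ∈ idealLattice ν 𝔡) →
      ∑ 𝔡 ∈ idealRange K D q, (cosetCount (idealLattice ν 𝔡) B (c 𝔡) : ℝ) ≤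
        B.ncard * (C * H ^ δ) + (idealRange K D q).card := by
  classical
  obtain ⟨C, hC, hdiv⟩ := exists_ncard_idealLattice_le hν hδ
  refine ⟨C, hC, fun H D q u B c hq hH hB hBH hc => ?_⟩
  have hcount : ∀ 𝔡 ∈ idealRange K D q, (cosetCount (idealLattice ν 𝔡) B (c 𝔡) : ℝ) =
      ∑ n ∈ hB.toFinset, if u + q • n ∈ idealLattice ν 𝔡 then (1 : ℝ) else 0 := by
    intro 𝔡 h𝔡
    rw [← Finset.sum_filter, Finset.sum_const, nsmul_eq_mul, mul_one, cosetCount,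
      ← Set.ncard_coe_finset]
    congr 2
    ext n
    simp [hc 𝔡 h𝔡]
  rw [Finset.sum_congr rfl hcount, Finset.sum_comm]
  have hn : ∀ n ∈ hB.toFinset, (∑ 𝔡 ∈ idealRange K D q,
      if u + q • n ∈ idealLattice ν 𝔡 then (1 : ℝ) else 0) ≤
      C * H ^ δ + if u + q • n = 0 then ((idealRange K D q).card : ℝ) else 0 := by
    intro n hn
    rw [← Finset.sum_filter, Finset.sum_const, nsmul_eq_mul, mul_one]
    have hpos : 0 ≤ C * H ^ δ := by positivity
    by_cases h0 : u + q • n = 0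
    · rw [if_pos h0]
      have : (((idealRange K D q).filter fun 𝔡 => u + q • n ∈ idealLattice ν 𝔡).card : ℝ) ≤
          (idealRange K D q).card := by exact_mod_cast Finset.card_filter_le _ _
      linarith
    · rw [if_neg h0, add_zero]
      obtain ⟨hfin, hle⟩ := hdiv H _ (hBH n ((Set.Finite.mem_toFinset hB).1 hn)) h0
      refine le_trans ?_ hle
      rw [← Set.ncard_coe_finset]
      refine Nat.cast_le.2 (Set.ncard_le_ncard (fun 𝔡 h => ?_) hfin)
      exact (Finset.mem_filter.1 (Finset.mem_coe.1 h)).2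
  refine (Finset.sum_le_sum hn).trans ?_
  rw [Finset.sum_add_distrib, Finset.sum_const, nsmul_eq_mul, Set.ncard_eq_toFinset_card B hB]
  gcongr
  rw [← Finset.sum_filter, Finset.sum_const, nsmul_eq_mul]
  -- The zero vector lies in every lattice and escapes the divisor bound. Since `q ≠ 0` it arises
  -- from at most one `n`, which costs one unit per ideal.
  have hone : (hB.toFinset.filter fun n => u + q • n = 0).card ≤ 1 := by
    rw [Finset.card_le_one]
    intro a ha b hb
    have h1 := (Finset.mem_filter.1 ha).2.trans (Finset.mem_filter.1 hb).2.symm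
    have h2 := add_left_cancel h1
    ext i
    have h3 := congrFun h2 i
    simpa [show q ≠ 0 by omega] using h3
  have hone' : ((hB.toFinset.filter fun n => u + q • n = 0).card : ℝ) ≤ 1 := by exact_mod_cast hone
  exact mul_le_of_le_one_left (Nat.cast_nonneg _) hone'

theorem exists_clog_le {ε : ℝ} (hε : 0 < ε) : ∃ C : ℝ, 0 < C ∧ ∀ (n : ℕ) (Y : ℝ), 2 ≤ n →
    (n : ℝ) ≤ Y → (Nat.clog 2 n : ℝ) ≤ C * Y ^ ε := by
  obtain ⟨B, hB1, hB⟩ := exists_succ_le_two_rpow hε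
  refine ⟨B, by linarith, fun n Y hn hnY => ?_⟩
  have h1 : 2 ^ (Nat.clog 2 n).pred < n := Nat.pow_pred_clog_lt_self (by norm_num) (by omega)
  have hc : 0 < Nat.clog 2 n := Nat.clog_pos (by norm_num) hn
  set e := (Nat.clog 2 n).pred with he
  have hce : (Nat.clog 2 n : ℝ) = e + 1 := by
    have : Nat.clog 2 n = e + 1 := (Nat.succ_pred_eq_of_pos hc).symm
    rw [this]; push_cast; rfl
  rw [hce]
  refine (hB e).trans ?_
  gcongr
  have h2 : (2 : ℝ) ^ e ≤ Y := by
    refine le_trans ?_ hnY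
    exact_mod_cast h1.le
  calc (2 : ℝ) ^ (ε * e) = ((2 : ℝ) ^ e) ^ ε := by
        rw [← Real.rpow_natCast, ← Real.rpow_mul (by norm_num), mul_comm]
    _ ≤ Y ^ ε := by gcongr

end Sums

/-! ### Boundary contributions and the case of axis-parallel lines. -/

theorem supNorm_le_of_abs_le {a : Fin 3 → ℤ} {H : ℝ} (h : ∀ i, |(a i : ℝ)| ≤ H) :
    (supNorm a : ℝ) ≤ H := by
  obtain ⟨i, -, hi⟩ := Finset.exists_mem_eq_sup Finset.univ Finset.univ_nonempty
    fun i => (a i).natAbs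
  have h1 : supNorm a = (a i).natAbs := hi
  rw [h1, Nat.cast_natAbs, Int.cast_abs]
  exact h i

theorem abs_le_of_mem_latticePts {R : Set (Fin 3 → ℝ)} {X : ℝ}
    (hR : R ⊆ Set.Icc (fun _ => -X) (fun _ => X)) {u : Fin 3 → ℤ} {q : ℕ} {n : Fin 3 → ℤ}
    (hn : n ∈ latticePts (rescale R u q) 0) (i : Fin 3) :
    |(((u + q • n) i : ℤ) : ℝ)| ≤ X := by
  have e : castVec u + (q : ℝ) • (castVec n + 0) = fun i => (((u + q • n) i : ℤ) : ℝ) := by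
    ext i; simp
  have h : (fun i => (((u + q • n) i : ℤ) : ℝ)) ∈ R := by rw [← e]; exact hn
  exact abs_le.2 ⟨(hR h).1 i, (hR h).2 i⟩

theorem supNorm_le_of_mem_leaving {R : Set (Fin 3 → ℝ)} {X : ℝ}
    (hR : R ⊆ Set.Icc (fun _ => -X) (fun _ => X)) {u : Fin 3 → ℤ} {q : ℕ} {n w : Fin 3 → ℤ}
    (hn : n ∈ leaving (latticePts (rescale R u q) 0) w) : (supNorm (u + q • n) : ℝ) ≤ X :=
  supNorm_le_of_abs_le (abs_le_of_mem_latticePts hR hn.1)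

theorem supNorm_le_of_mem_entering {R : Set (Fin 3 → ℝ)} {X : ℝ}
    (hR : R ⊆ Set.Icc (fun _ => -X) (fun _ => X)) {u : Fin 3 → ℤ} {q L : ℕ} {n w : Fin 3 → ℤ}
    (hw : w ∈ cube L) (hn : n ∈ entering (latticePts (rescale R u q) 0) w) :
    (supNorm (u + q • n) : ℝ) ≤ X + q * L := by
  refine supNorm_le_of_abs_le fun i => ?_
  have h1 := abs_le_of_mem_latticePts hR hn.1 i
  have h2 := Finset.mem_Ico.1 (Fintype.mem_piFinset.1 hw i)
  have h3 : (0 : ℝ) ≤ w i := by exact_mod_cast h2.1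
  have h4 : (w i : ℝ) ≤ L := by exact_mod_cast h2.2.le
  have h5 : (((u + q • n) i : ℤ) : ℝ) = (((u + q • (n + w)) i : ℤ) : ℝ) - q * w i := by
    simp; ring
  have h6 : (q : ℝ) * w i ≤ q * L := by gcongr
  have h7 : 0 ≤ (q : ℝ) * w i := by positivity
  rw [h5]
  rw [abs_le] at h1 ⊢
  constructor <;> linarith [h1.1, h1.2]

variable {K : Type*} [Field K] [NumberField K]

/-- The contribution of the boundary of the region, summed over the ideals. -/
theorem exists_sum_boundary_le {ν : Fin 4 → 𝓞 K}
    (hν : LinearIndependent ℚ (fun i => (ν i : K))) (k : ℕ) {ε : ℝ} (hε : 0 < ε) :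
    ∃ C : ℝ, 0 < C ∧ ∀ (X D : ℝ) (q L : ℕ) (u : Fin 3 → ℤ) (R : Set (Fin 3 → ℝ))
      (c : Ideal (𝓞 K) → Fin 3 → ℤ), 1 ≤ X → 0 < D → 1 ≤ q → 1 ≤ L →
      R ⊆ Set.Icc (fun _ => -X) (fun _ => X) → AxisNice R k → X + q * L ≤ 8 * (X * D) →
      (∀ 𝔡 ∈ idealRange K D q, ∀ n, n - c 𝔡 ∈ idealLattice ν 𝔡 ↔ u + q • n ∈ idealLattice ν 𝔡) →
      ∑ 𝔡 ∈ idealRange K D q, (∑ w ∈ cube L,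
        ((cosetCount (idealLattice ν 𝔡) (leaving (latticePts (rescale R u q) 0) w) (c 𝔡) : ℝ) +
          cosetCount (idealLattice ν 𝔡) (entering (latticePts (rescale R u q) 0) w) (c 𝔡))) /
          (L : ℝ) ^ 3 ≤
        C * (X ^ 2 * X ^ ε * (L * D ^ ε)) + 2 * (idealRange K D q).card := by
  obtain ⟨C, hC, hsum⟩ := exists_sum_cosetCount_le hν hε
  refine ⟨294 * k * (C * 8 ^ ε) + 1, by positivity,
    fun X D q L u R c hX hD hq hL hR hnice hH hc => ?_⟩
  set A := latticePts (rescale R u q) 0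
  have hW := spreadLE_rescale hR u hq
  have hA : A.Finite := finite_latticePts hW 0
  have hL0 : (0 : ℝ) < L := by exact_mod_cast hL
  have hXD : 0 < X * D := by positivity
  have h7 := two_mul_ceil_add_one_le hX
  have hqL : 0 ≤ (q : ℝ) * L := by positivity
  set Z := C * (8 * (X * D)) ^ ε with hZ
  have hZ0 : 0 ≤ Z := by positivity
  have hM : ∀ w ∈ cube L, ((leaving A w).ncard : ℝ) ≤ 147 * k * X ^ 2 * L := by
    intro w hw
    have h1 : ((leaving A w).ncard : ℝ) ≤ 3 * L * (k * (2 * (⌈2 * X⌉₊ : ℝ) + 1) ^ 2) := by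
      exact_mod_cast ncard_leaving_cube_le hW (hnice.rescale u q) hw
    have h2 : (3 * L * (k * (2 * (⌈2 * X⌉₊ : ℝ) + 1) ^ 2)) ≤ 3 * L * (k * (7 * X) ^ 2) := by
      gcongr
    refine h1.trans (h2.trans_eq ?_)
    ring
  have hw : ∀ w ∈ cube L, (∑ 𝔡 ∈ idealRange K D q,
      ((cosetCount (idealLattice ν 𝔡) (leaving A w) (c 𝔡) : ℝ) +
        cosetCount (idealLattice ν 𝔡) (entering A w) (c 𝔡))) ≤
      2 * (147 * k * X ^ 2 * L * Z + (idealRange K D q).card) := by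
    intro w hw
    have h1 := hsum (8 * (X * D)) D q u (leaving A w) c hq (by positivity) (finite_leaving hA w)
      (fun n hn => (supNorm_le_of_mem_leaving hR hn).trans (by linarith)) hc
    have h2 := hsum (8 * (X * D)) D q u (entering A w) c hq (by positivity) (finite_entering hA w)
      (fun n hn => (supNorm_le_of_mem_entering hR hw hn).trans hH) hc
    rw [ncard_entering hA] at h2
    rw [Finset.sum_add_distrib]
    have h3 := mul_le_mul_of_nonneg_right (hM w hw) hZ0
    linarith
  rw [← Finset.sum_div, Finset.sum_comm, div_le_iff₀ (by positivity)]
  refine (Finset.sum_le_sum hw).trans ?_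
  rw [Finset.sum_const, card_cube, nsmul_eq_mul]
  push_cast
  rw [mul_comm]
  gcongr
  have hZ' : Z = C * 8 ^ ε * (X ^ ε * D ^ ε) := by
    rw [hZ, Real.mul_rpow (by norm_num) hXD.le, Real.mul_rpow (by linarith) hD.le]; ring
  have hpos : 0 ≤ X ^ 2 * X ^ ε * (L * D ^ ε) := by positivity
  rw [hZ']
  nlinarith

/-- The factor `X^ε` has two sources, the divisor bound for boundary points and the number of dyadic
scales. -/
theorem exists_typeISum_le_of_axisNice {ν : Fin 4 → 𝓞 K}
    (hν : LinearIndependent ℚ (fun i => (ν i : K))) (k : ℕ) {ε : ℝ} (hε : 0 < ε) :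
    ∃ C : ℝ, 0 < C ∧ ∀ (X D : ℝ) (q : ℕ) (u : Fin 3 → ℤ) (R : Set (Fin 3 → ℝ)),
      1 ≤ X → 1 ≤ 2 * D → 1 ≤ q → (q : ℝ) ≤ X → R ⊆ Set.Icc (fun _ => -X) (fun _ => X) →
      MeasureTheory.NullMeasurableSet R MeasureTheory.volume → AxisNice R k →
      typeISum ν R u q D ≤ C * (X ^ (2 + ε) * D ^ (1 / 3 + ε) + D) := by
  obtain ⟨C1, hC1, h1⟩ := exists_sum_inv_minNorm_sq_le hν hε
  obtain ⟨C2, hC2, h2⟩ := exists_card_idealRange_le K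
  obtain ⟨C3, hC3, h3⟩ := exists_clog_le hε
  obtain ⟨C4, hC4, h4⟩ := exists_sum_boundary_le hν k hε
  set b1 : ℝ := 51450000 * k * (C3 * 7 ^ ε) with hb1
  refine ⟨3 * C4 + b1 * (C1 + C2 * 2 ^ ε) + (3430000 + 147 * k) * C1 + 70002 * C2, by positivity,
    fun X D q u R hX hD hq hqX hR hm hnice => ?_⟩
  have hD0 : 0 < D := by linarith
  have hX0 : 0 < X := by linarith
  set t : ℝ := D ^ (1 / 3 : ℝ) with ht
  have ht0 : 0 < t := Real.rpow_pos_of_pos hD0 _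
  have ht3 : t ^ 3 = D := by
    rw [ht, ← Real.rpow_natCast, ← Real.rpow_mul hD0.le]; norm_num
  have htD : t ≤ 2 * D := by
    have e1 : t ≤ (2 * D) ^ (1 / 3 : ℝ) := by rw [ht]; gcongr; linarith
    refine e1.trans ((Real.rpow_le_rpow_of_exponent_le hD
      (by norm_num : (1 / 3 : ℝ) ≤ 1)).trans_eq ?_)
    rw [Real.rpow_one]
  have ht2 : 1 / 2 ≤ t := by
    by_contra hlt
    rw [not_le] at hlt
    have : t ^ 3 < (1 / 2) ^ 3 := by gcongr
    rw [ht3] at this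
    norm_num at this
    linarith
  -- The boundary costs about `X²L` and the small scales about `X²D/L²`; both are about `X²D^(1/3)`
  -- for this choice.
  set L := ⌈t⌉₊ with hLdef
  have htL : t ≤ L := Nat.le_ceil t
  have hL3 : (L : ℝ) ≤ 3 * t := by
    have := Nat.ceil_lt_add_one ht0.le
    linarith
  have hL1 : 1 ≤ L := Nat.one_le_iff_ne_zero.2 (Nat.ceil_pos.2 ht0).ne'
  -- This height bound makes the divisor bound for boundary points `O((XD)^ε)`; it uses `q ≤ X` and
  -- `1 ≤ 2D`.
  have hH : X + q * L ≤ 8 * (X * D) := by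
    have e1 : (q : ℝ) * L ≤ X * (6 * D) := by
      gcongr; linarith
    nlinarith
  set W := ⌈2 * X⌉₊ with hWdef
  have h7 : 2 * (W : ℝ) + 1 ≤ 7 * X := two_mul_ceil_add_one_le hX
  have hW := spreadLE_rescale hR u hq
  set J := Nat.clog 2 (2 * W + 1) with hJ
  have hJle : (J : ℝ) ≤ C3 * 7 ^ ε * X ^ ε := by
    have e1 : 1 ≤ W := Nat.one_le_iff_ne_zero.2 (Nat.ceil_pos.2 (by linarith)).ne'
    have e2 := h3 (2 * W + 1) (7 * X) (by omega) (by push_cast; exact h7)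
    rwa [Real.mul_rpow (by norm_num) hX0.le, ← mul_assoc] at e2
  have hterm : ∀ 𝔡, ∃ c : Fin 3 → ℤ, 𝔡 ∈ idealRange K D q →
      (∀ n, n - c ∈ idealLattice ν 𝔡 ↔ u + q • n ∈ idealLattice ν 𝔡) ∧
      |((GamDvd ν R u q 𝔡).ncard : ℝ) -
        rho ν 𝔡 * MeasureTheory.volume.real R / ((q : ℝ) ^ 3 * (Ideal.absNorm 𝔡 : ℝ))| ≤
      (∑ w ∈ cube L,
        ((cosetCount (idealLattice ν 𝔡) (leaving (latticePts (rescale R u q) 0) w) c : ℝ) +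
          cosetCount (idealLattice ν 𝔡) (entering (latticePts (rescale R u q) 0) w) c)) /
          (L : ℝ) ^ 3 + (b1 * (X ^ 2 * X ^ ε) + (3430000 + 147 * k) * X ^ 2) *
            (1 / (minNorm (idealLattice ν 𝔡) : ℝ) ^ 2) +
          (b1 * (X ^ 2 * X ^ ε) * (1 / t ^ 2) + 70000) := by
    intro 𝔡
    by_cases h𝔡 : 𝔡 ∈ idealRange K D q
    · have hN := (idealRange_pos hD0 h𝔡).2.2.2
      obtain ⟨c, hc, hle⟩ := abs_term_le hν u hX hD0 hq hR hm hnice h𝔡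
      refine ⟨c, fun _ => ⟨hc, ?_⟩⟩
      have hm1 := one_le_minNorm ν hN
      have hmain := abs_cosetCount_sub_le_of_axisNice hW (hnice.rescale u q) hN
        (absNorm_nsmul_mem_idealLattice ν 𝔡) (index_idealLattice_ne_zero ν hN) hm1
        (fun a ha h0 => minNorm_le ha h0) hL1 c
      set m := minNorm (idealLattice ν 𝔡)
      have hmpos : (0 : ℝ) < m := by exact_mod_cast hm1
      have e0 : (2 * (W : ℝ) + 1) ^ 2 ≤ 49 * X ^ 2 := by
        have : (2 * (W : ℝ) + 1) ^ 2 ≤ (7 * X) ^ 2 := by gcongr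
        linarith
      have e1 : (J : ℝ) * (1050000 * (k * (2 * W + 1) ^ 2) * (1 / (m : ℝ) ^ 2 + 1 / (L : ℝ) ^ 2)) ≤
          (C3 * 7 ^ ε * X ^ ε) *
            (1050000 * (k * (49 * X ^ 2)) * (1 / (m : ℝ) ^ 2 + 1 / t ^ 2)) := by
        gcongr
      have e2 : (C3 * 7 ^ ε * X ^ ε) *
            (1050000 * (k * (49 * X ^ 2)) * (1 / (m : ℝ) ^ 2 + 1 / t ^ 2)) =
          b1 * (X ^ 2 * X ^ ε) * (1 / (m : ℝ) ^ 2) + b1 * (X ^ 2 * X ^ ε) * (1 / t ^ 2) := by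
        rw [hb1]; ring
      have e3 : (2 * (W : ℝ) + 1) ^ 2 / (m : ℝ) ^ 2 ≤ 49 * X ^ 2 * (1 / (m : ℝ) ^ 2) := by
        rw [mul_one_div]; gcongr
      rw [e2] at e1
      linarith
    -- Off the range any vector will do; the default makes `c` a function of all ideals.
    · exact ⟨0, fun h => absurd h h𝔡⟩
  choose c hc using hterm
  have hbd := h4 X D q L u R c hX hD0 hq hL1 hR hnice hH fun 𝔡 h => (hc 𝔡 h).1
  have hcard := h2 D q hD
  have hmin := h1 D q hD
  refine (Finset.sum_le_sum fun 𝔡 h => (hc 𝔡 h).2).trans ?_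
  rw [Finset.sum_add_distrib, Finset.sum_add_distrib, ← Finset.mul_sum, Finset.sum_const,
    nsmul_eq_mul]
  have hT : D ^ (1 / 3 + ε) = t * D ^ ε := Real.rpow_add hD0 _ _
  rw [hT] at hmin ⊢
  have hXp : X ^ (2 + ε) = X ^ 2 * X ^ ε := by
    rw [Real.rpow_add hX0]; norm_num
  rw [hXp]
  set Y := X ^ 2 * X ^ ε with hY
  have hY0 : 0 < Y := by positivity
  have hXY : X ^ 2 ≤ Y := le_mul_of_one_le_right (by positivity) (Real.one_le_rpow hX hε.le)
  set E := D ^ ε with hE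
  have hE0 : 0 < E := by positivity
  have hE1 : 1 ≤ 2 ^ ε * E := by
    rw [hE, ← Real.mul_rpow (by norm_num) hD0.le]; exact Real.one_le_rpow hD hε.le
  have hb0 : 0 ≤ b1 := by positivity
  have f1 : C4 * (Y * (L * E)) ≤ 3 * C4 * (Y * (t * E)) := by
    have : C4 * (Y * (L * E)) ≤ C4 * (Y * (3 * t * E)) := by gcongr
    linarith
  have f2 : (b1 * Y + (3430000 + 147 * k) * X ^ 2) * ∑ 𝔡 ∈ idealRange K D q,
      1 / (minNorm (idealLattice ν 𝔡) : ℝ) ^ 2 ≤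
      (b1 * Y + (3430000 + 147 * k) * Y) * (C1 * (t * E)) := by gcongr
  have f3 : ((idealRange K D q).card : ℝ) * (b1 * Y * (1 / t ^ 2) + 70000) ≤
      b1 * Y * (C2 * (2 ^ ε * (t * E))) + 70000 * (C2 * D) := by
    have g1 : ((idealRange K D q).card : ℝ) * (1 / t ^ 2) ≤ C2 * (2 ^ ε * (t * E)) := by
      calc _ ≤ C2 * D * (1 / t ^ 2) := by gcongr
        _ = C2 * (t * 1) := by rw [← ht3]; field_simp
        _ ≤ C2 * (t * (2 ^ ε * E)) := by gcongr
        _ = _ := by ring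
    have g2 := mul_le_mul_of_nonneg_left g1 (by positivity : 0 ≤ b1 * Y)
    linarith
  have hYE : 0 < Y * (t * E) := by positivity
  have p1 : 0 ≤ 3 * C4 + b1 * (C1 + C2 * 2 ^ ε) + (3430000 + 147 * k) * C1 := by positivity
  have p2 := mul_nonneg p1 hD0.le
  have p3 : 0 ≤ 70002 * C2 * (Y * (t * E)) := by positivity
  linarith

end IncompleteNorm

end

/-! ### Assembly of the two cases. -/

theorem mainTheorem6 (K : Type*) [Field K] [NumberField K]
    (hK : Module.finrank ℚ K = 4)
    (ν : Fin 4 → 𝓞 K)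
    (hν : LinearIndependent ℚ (fun i => (ν i : K)))
    (hν_one : ν 0 = 1)
    (hν_gen : IntermediateField.adjoin ℚ {(ν 1 : K)} = ⊤)
    (k : ℕ) (ε : ℝ) (hε : 0 < ε) :
    ∃ C : ℝ, 0 < C ∧
      ∀ (X D : ℝ) (q : ℕ) (u : Fin 3 → ℤ) (R : Set (Fin 3 → ℝ)),
        0 < D → 1 ≤ q → (q : ℝ) ≤ Real.sqrt X →
        R ⊆ Set.Icc (fun _ => -X) (fun _ => X) →
        MeasureTheory.NullMeasurableSet R MeasureTheory.volume →
          (IncompleteNorm.AxisNice R k →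
            IncompleteNorm.typeISum ν R u q D ≤
              C * (X ^ (2 + ε) * (q : ℝ) ^ (1 + ε) * D ^ (1 / 3 + ε)
                + D * (q : ℝ) ^ (4 + ε))) ∧
          (IncompleteNorm.LineNice R k →
            IncompleteNorm.typeISum ν R u q D ≤
              C * (X ^ (2 : ℕ) * (q : ℝ) ^ (1 + ε) * D ^ (1 / 3 + ε)
                + D * (q : ℝ) ^ (4 + ε))) := by
  obtain ⟨C1, hC1, h1⟩ := IncompleteNorm.exists_typeISum_le_of_axisNice hν k hε
  obtain ⟨C2, hC2, h2⟩ := IncompleteNorm.exists_typeISum_le_of_lineNice hν k hε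
  refine ⟨C1 + C2, by positivity, fun X D q u R hD hq hqX hR hm => ?_⟩
  have hq1 : (1 : ℝ) ≤ q := by exact_mod_cast hq
  have hsqrt : 1 ≤ Real.sqrt X := hq1.trans hqX
  have hX : 1 ≤ X := by rwa [Real.one_le_sqrt] at hsqrt
  have hqX' : (q : ℝ) ≤ X := by
    have := Real.sq_sqrt (by linarith : 0 ≤ X)
    nlinarith
  have hqa : 1 ≤ (q : ℝ) ^ (1 + ε) := Real.one_le_rpow hq1 (by linarith)
  have hqb : 1 ≤ (q : ℝ) ^ (4 + ε) := Real.one_le_rpow hq1 (by linarith)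
  -- Both cases were proved without powers of `q`; as `q ≥ 1` these only enlarge the bound.
  have hgen : ∀ P : ℝ, 0 ≤ P → P * D ^ (1 / 3 + ε) + D ≤
      P * (q : ℝ) ^ (1 + ε) * D ^ (1 / 3 + ε) + D * (q : ℝ) ^ (4 + ε) := by
    intro P hP
    have hT : 0 ≤ D ^ (1 / 3 + ε) := by positivity
    have e1 := le_mul_of_one_le_right hP hqa
    have e2 := le_mul_of_one_le_right hD.le hqb
    have e3 := mul_le_mul_of_nonneg_right e1 hT
    linarith
  have hX0 : 0 ≤ X := by linarith
  -- For `2D < 1` no ideal of nonzero norm is in range and the sum is empty.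
  rcases lt_or_ge (2 * D) 1 with hsmall | hlarge
  · have hempty : IncompleteNorm.typeISum ν R u q D = 0 := by
      rw [IncompleteNorm.typeISum, Finset.sum_eq_zero]
      intro 𝔡 h
      obtain ⟨-, h3, -, h4⟩ := IncompleteNorm.idealRange_pos hD h
      have : (1 : ℝ) ≤ Ideal.absNorm 𝔡 := by exact_mod_cast Nat.one_le_iff_ne_zero.2 h4
      linarith
    rw [hempty]
    exact ⟨fun _ => by positivity, fun _ => by positivity⟩
  · refine ⟨fun h => ?_, fun h => ?_⟩
    · refine (h1 X D q u R hX hlarge hq hqX' hR hm h).trans ?_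
      have := hgen (X ^ (2 + ε)) (by positivity)
      gcongr
      linarith
    · refine (h2 X D q u R hX hlarge hq hR hm h).trans ?_
      have := hgen (X ^ (2 : ℕ)) (by positivity)
      gcongr
      linarith
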